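/- For an irrational number $\omega\in(0,1)$ let $\omega=[a_1(\omega),a_2(\omega),\dots]=\cfrac{1}{a_1(\omega)+\cfrac{1}{a_2(\omega)+\cdots}}$ be its regular continued fraction expansion, with partial quotients $a_k(\omega)\in\{1,2,3,\dots\}$, and let $R_n(\omega)=\#\{a_1(\omega),\dots,a_n(\omega)\}$ be the number of distinct values among the first $n$ partial quotients. For real numbers $\beta$ and $c$ put $$E(\beta,c)=\Big\{\omega\in(0,1)\setminus\mathbb{Q}:\ \lim_{n\to\infty}\frac{R_n(\omega)}{n^\beta}=c\Big\},\qquad F(c)=E(1,c)=\Big\{\omega\in(0,1)\setminus\mathbb{Q}:\ \lim_{n\to\infty}\frac{R_n(\omega)}{n}=c\Big\}.$$ Then: (1) for every $\beta\in(0,1)$ and every $c>0$, the set $E(\beta,c)$ has Hausdorff dimension $1$; (2) for every $c\in(0,1]$, the set $F(c)$ has Hausdorff dimension $\tfrac12$. -/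

import Mathlib

open Filter Topology

noncomputable section

namespace ContFracRange

/-- The Gauss map `T x = 1 / x (mod 1)`. -/
def gaussMap (x : ℝ) : ℝ := Int.fract x⁻¹

/-- The partial quotients of `ω = [a₁, a₂, …]`, indexed from zero: `partialQuotient ω k` is
`a_{k+1}(ω) = ⌊1 / T^k ω⌋`. Only used for irrational `ω` in `(0, 1)`. -/
def partialQuotient (ω : ℝ) (k : ℕ) : ℕ := ⌊(gaussMap^[k] ω)⁻¹⌋₊

/-- `R_n(ω)`, the number of distinct values among the first `n` partial quotients
`a₁(ω), …, a_n(ω)`. -/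
def R (n : ℕ) (ω : ℝ) : ℕ := ((Finset.range n).image (partialQuotient ω)).card

/-- `E(β, c)`: the irrational `ω` in `(0, 1)` with `R_n(ω) / n^β → c`. -/
def E (β c : ℝ) : Set ℝ :=
  {ω | ω ∈ Set.Ioo (0 : ℝ) 1 ∧ Irrational ω ∧
    Tendsto (fun n : ℕ => (R n ω : ℝ) / (n : ℝ) ^ β) atTop (𝓝 c)}

/-- `F(c)`: the irrational `ω` in `(0, 1)` with `R_n(ω) / n → c`. -/
def F (c : ℝ) : Set ℝ :=
  {ω | ω ∈ Set.Ioo (0 : ℝ) 1 ∧ Irrational ω ∧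
    Tendsto (fun n : ℕ => (R n ω : ℝ) / (n : ℝ)) atTop (𝓝 c)}

/-- Iterates of the Gauss map keep irrational numbers of `(0, 1)` irrational and in `(0, 1)`. -/
theorem gaussMap_iterate_mem {ω : ℝ} (h : ω ∈ Set.Ioo (0 : ℝ) 1) (hi : Irrational ω) (k : ℕ) :
    gaussMap^[k] ω ∈ Set.Ioo (0 : ℝ) 1 ∧ Irrational (gaussMap^[k] ω) := by
  induction k with
  | zero => exact ⟨h, hi⟩
  | succ k ih =>
    rw [Function.iterate_succ_apply']
    have hir : Irrational (gaussMap (gaussMap^[k] ω)) := by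
      unfold gaussMap Int.fract
      exact ih.2.inv.sub_intCast _
    exact ⟨⟨lt_of_le_of_ne (Int.fract_nonneg _) (fun e => hir.ne_zero e.symm),
      Int.fract_lt_one _⟩, hir⟩

/-- Agreement with Mathlib's regular continued fraction expansion of a real number. -/
theorem partDens_get?_of {ω : ℝ} (h : ω ∈ Set.Ioo (0 : ℝ) 1) (hi : Irrational ω) (k : ℕ) :
    (GenContFract.of ω).partDens.get? k = some (partialQuotient ω k : ℝ) := by
  have hs : ∀ k, ∃ b, GenContFract.IntFractPair.stream ω k = some ⟨b, gaussMap^[k] ω⟩ := by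
    intro k
    induction k with
    | zero =>
      refine ⟨⌊ω⌋, ?_⟩
      have : Int.fract ω = ω := Int.fract_eq_self.2 ⟨h.1.le, h.2⟩
      simp [GenContFract.IntFractPair.stream, GenContFract.IntFractPair.of, this]
    | succ k ih =>
      obtain ⟨b, hb⟩ := ih
      refine ⟨⌊(gaussMap^[k] ω)⁻¹⌋, ?_⟩
      rw [GenContFract.IntFractPair.stream_succ_of_some hb
        (gaussMap_iterate_mem h hi k).1.1.ne', Function.iterate_succ_apply']
      rfl
  obtain ⟨b, hb⟩ := hs k
  have hm := (gaussMap_iterate_mem h hi k).1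
  have hf : (⌊(gaussMap^[k] ω)⁻¹⌋ : ℝ) = (partialQuotient ω k : ℝ) := by
    unfold partialQuotient
    rw [← natCast_floor_eq_intCast_floor (inv_nonneg.2 hm.1.le)]
  have := GenContFract.get?_of_eq_some_of_get?_intFractPair_stream_fr_ne_zero hb hm.1.ne'
  rw [GenContFract.partDen_eq_s_b this]
  exact congrArg some hf

end ContFracRange

end

noncomputable section

namespace ContFracRange

/-! Upper bound for `F c`: if k distinct values occur among the first n partial quotients, the
product P of these quotients is at least k!, and the cylinder has diameter at most P⁻². On `F c` one
may take k = ⌊cn/2⌋ for large n. The sum of P^(-(1+2η)) over the words with P ≥ k! is at most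
ζ(1+η)^n (k!)^(-η), which is bounded in n because k! outgrows every exponential. Hence the dimension
is at most 1/2 + η (`dimH_manyDistinct_le`).

Lower bounds: take f with increments 0 or 1 and f(n) = c n^β + O(1). Digits stay in {1, …, N},
except that each increase of f uses a digit from a fresh block, so R_n = f(n) + O(1)
(`cfValue_mem_E`). Numbers t in [0, 1) are coded by such digit sequences through tiles of relative
length c_n · ratio^s (`exists_coding`). The map from the continued fraction back to t is Hölder of
every exponent below s, provided ∏ c_i and the digit bounds are negligible against every negative
power of the cylinder length (`le_dimH_of_digits`).

For β = 1, s = 1/2, the blocks are [2^j, 2^(j+1)): 2^j cylinders of relative length about 4^(-j),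
whose square roots have a sum bounded below. Linearly many such digits make cylinder lengths decay
like 2^(-const · n²), so the cost 4^n is negligible. For β < 1 the new digit is forced, at a total
cost e^(o(n)) that is negligible against 2^(-n), while the free digits up to a large N allow any s <
1. -/

/-! ### Hölder criterion and tilings of the unit interval. -/

/-- If a map on `[0, 1)` is the inverse of a Hölder map of exponent `r`, its image has dimension
at least `r`. -/
theorem le_dimH_of_le_dist_rpow {X : Set ℝ} {φ : ℝ → ℝ} {K r : NNReal} (hr : 0 < r)
    (hX : ∀ t ∈ Set.Ico (0 : ℝ) 1, φ t ∈ X)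
    (hφ : ∀ t ∈ Set.Ico (0 : ℝ) 1, ∀ t' ∈ Set.Ico (0 : ℝ) 1,
      dist t t' ≤ K * dist (φ t) (φ t') ^ (r : ℝ)) :
    (r : ENNReal) ≤ dimH X := by
  have hinj : Set.InjOn φ (Set.Ico (0 : ℝ) 1) := by
    intro t ht t' ht' h
    have := hφ t ht t' ht'
    rw [h, dist_self, Real.zero_rpow (by positivity), mul_zero] at this
    exact dist_le_zero.1 this
  set ψ := Function.invFunOn φ (Set.Ico (0 : ℝ) 1)
  have hψ : ∀ t ∈ Set.Ico (0 : ℝ) 1, ψ (φ t) = t := fun t ht => hinj.leftInvOn_invFunOn ht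
  have hH : HolderOnWith K r ψ (φ '' Set.Ico (0 : ℝ) 1) := by
    rintro _ ⟨t, ht, rfl⟩ _ ⟨t', ht', rfl⟩
    rw [hψ t ht, hψ t' ht', edist_dist, edist_dist,
      ENNReal.ofReal_rpow_of_nonneg dist_nonneg r.coe_nonneg,
      ← ENNReal.ofReal_coe_nnreal, ← ENNReal.ofReal_mul K.coe_nonneg]
    exact ENNReal.ofReal_le_ofReal (hφ t ht t' ht')
  have him : ψ '' (φ '' Set.Ico (0 : ℝ) 1) = Set.Ico (0 : ℝ) 1 := hinj.invFunOn_image subset_rfl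
  have h1 := hH.dimH_image_le hr
  rw [him, Real.dimH_of_nonempty_interior (by simp [interior_Ico])] at h1
  have hr0 : (r : ENNReal) ≠ 0 := by simpa using hr.ne'
  rw [ENNReal.le_div_iff_mul_le (Or.inl hr0) (Or.inl ENNReal.coe_ne_top),
    Module.finrank_self, Nat.cast_one, one_mul] at h1
  refine h1.trans (dimH_mono ?_)
  rintro _ ⟨t, ht, rfl⟩
  exact hX t ht

/-- Intervals of lengths `ρ a`, `a ∈ D`, laid end to end cover `[0, ∑ a ∈ D, ρ a)`. -/
theorem exists_tiling (D : Finset ℕ) (ρ : ℕ → ℝ) : ∃ S : ℕ → ℝ,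
    ∀ t, 0 ≤ t → t < ∑ a ∈ D, ρ a → ∃ a ∈ D, S a ≤ t ∧ t < S a + ρ a := by
  induction D using Finset.induction_on with
  | empty => exact ⟨0, fun t h0 h1 => absurd h1 (by simpa using h0)⟩
  | insert a D ha ih =>
    obtain ⟨S, hS⟩ := ih
    refine ⟨Function.update S a (∑ a ∈ D, ρ a), fun t h0 h1 => ?_⟩
    rw [Finset.sum_insert ha] at h1
    by_cases h : t < ∑ a ∈ D, ρ a
    · obtain ⟨b, hb, h2⟩ := hS t h0 h
      have hba : b ≠ a := fun e => ha (e ▸ hb)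
      exact ⟨b, Finset.mem_insert_of_mem hb, by simpa [hba] using h2⟩
    · exact ⟨a, Finset.mem_insert_self _ _, by simpa using not_lt.1 h, by simpa using by linarith⟩

/-! ### Infinite continued fractions with prescribed digits. -/

/-- The finite continued fraction `[a 0, …, a (n - 1)]`. -/
def finiteValue : ℕ → (ℕ → ℕ) → ℝ
  | 0, _ => 0
  | n + 1, a => 1 / (a 0 + finiteValue n fun k => a (k + 1))

theorem finiteValue_mem {a : ℕ → ℕ} (ha : ∀ k, 1 ≤ a k) (n : ℕ) :
    finiteValue n a ∈ Set.Icc (0 : ℝ) 1 := by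
  induction n generalizing a with
  | zero => simp [finiteValue]
  | succ n ih =>
    have h := ih (a := fun k => a (k + 1)) fun k => ha _
    have h1 : (1 : ℝ) ≤ a 0 := by exact_mod_cast ha 0
    have h2 : 1 ≤ (a 0 : ℝ) + finiteValue n fun k => a (k + 1) := by linarith [h.1]
    exact ⟨by unfold finiteValue; positivity,
      by unfold finiteValue; exact div_le_one_of_le₀ h2 (by linarith)⟩

theorem abs_one_div_sub_one_div {x y a : ℝ} (ha : 0 < a) (hx : 0 ≤ x) (hy : 0 ≤ y) :
    |1 / (a + x) - 1 / (a + y)| = |x - y| / ((a + x) * (a + y)) := by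
  have h1 : 0 < a + x := by linarith
  have h2 : 0 < a + y := by linarith
  rw [div_sub_div _ _ h1.ne' h2.ne', abs_div, abs_of_pos (mul_pos h1 h2), abs_sub_comm x y]
  congr 2
  ring

/-- One digit equal to 1 need not contract (the slope of 1/(1+x) at 0 is -1), but two digits
together contract by a factor 4; hence the two-step induction. -/
theorem abs_finiteValue_succ_sub_le (n : ℕ) : ∀ {a : ℕ → ℕ}, (∀ k, 1 ≤ a k) →
    |finiteValue n a - finiteValue (n + 1) a| ≤ 2 * (1 / 2) ^ n := by
  induction n using Nat.twoStepInduction with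
  | zero =>
    intro a ha
    have h := finiteValue_mem ha 1
    simp only [finiteValue] at h ⊢
    rw [zero_sub, abs_neg, abs_of_nonneg h.1]
    linarith [h.2]
  | one =>
    intro a ha
    have h := finiteValue_mem ha 1
    have h' := finiteValue_mem ha 2
    rw [abs_le]
    constructor <;> norm_num <;> linarith [h.1, h.2, h'.1, h'.2]
  | more n ih _ =>
    intro a ha
    have h := finiteValue_mem (a := fun k => a (k + 2)) (fun k => ha _) n
    have h' := finiteValue_mem (a := fun k => a (k + 2)) (fun k => ha _) (n + 1)
    have ih := ih (a := fun k => a (k + 2)) fun k => ha _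
    have e1 : finiteValue (n + 2) a
        = 1 / (a 0 + 1 / (a 1 + finiteValue n fun k => a (k + 2))) := rfl
    have e2 : finiteValue (n + 2 + 1) a
        = 1 / (a 0 + 1 / (a 1 + finiteValue (n + 1) fun k => a (k + 2))) := rfl
    rw [e1, e2]
    set x := finiteValue n fun k => a (k + 2)
    set y := finiteValue (n + 1) fun k => a (k + 2)
    have p0 : (1 : ℝ) ≤ a 0 := by exact_mod_cast ha 0
    have p1 : (1 : ℝ) ≤ a 1 := by exact_mod_cast ha 1
    have hx := h.1
    have hy := h'.1
    have hx1 : 0 < (a 1 : ℝ) + x := by linarith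
    have hy1 : 0 < (a 1 : ℝ) + y := by linarith
    rw [abs_one_div_sub_one_div (by linarith) (by positivity) (by positivity),
      abs_one_div_sub_one_div (by linarith) hx hy, div_div]
    have e : ((a 1 : ℝ) + x) * (a 1 + y) * ((a 0 + 1 / (a 1 + x)) * (a 0 + 1 / (a 1 + y)))
        = (a 0 * (a 1 + x) + 1) * (a 0 * (a 1 + y) + 1) := by
      field_simp
    rw [e]
    have q1 : 2 ≤ (a 0 : ℝ) * (a 1 + x) + 1 := by nlinarith
    have q2 : 2 ≤ (a 0 : ℝ) * (a 1 + y) + 1 := by nlinarith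
    have q3 : (4 : ℝ) ≤ (a 0 * (a 1 + x) + 1) * (a 0 * (a 1 + y) + 1) := by nlinarith
    calc _ ≤ |x - y| / 4 := by gcongr
      _ ≤ (2 * (1 / 2) ^ n) / 4 := by gcongr
      _ = _ := by rw [pow_add]; ring

/-- The value of the infinite continued fraction `[a 0, a 1, …]`. -/
def cfValue (a : ℕ → ℕ) : ℝ := limUnder atTop fun n => finiteValue n a

theorem tendsto_cfValue {a : ℕ → ℕ} (ha : ∀ k, 1 ≤ a k) :
    Tendsto (fun n => finiteValue n a) atTop (𝓝 (cfValue a)) :=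
  (cauchySeq_of_le_geometric (1 / 2) 2 (by norm_num) fun n => by
    rw [Real.dist_eq]; exact abs_finiteValue_succ_sub_le n ha).tendsto_limUnder

theorem cfValue_mem_Icc {a : ℕ → ℕ} (ha : ∀ k, 1 ≤ a k) : cfValue a ∈ Set.Icc (0 : ℝ) 1 :=
  isClosed_Icc.mem_of_tendsto (tendsto_cfValue ha) (Eventually.of_forall (finiteValue_mem ha))

theorem cfValue_eq {a : ℕ → ℕ} (ha : ∀ k, 1 ≤ a k) :
    cfValue a = 1 / (a 0 + cfValue fun k => a (k + 1)) := by
  have hs : ∀ k, 1 ≤ a (k + 1) := fun k => ha _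
  have h1 := (tendsto_add_atTop_iff_nat 1).2 (tendsto_cfValue ha)
  refine tendsto_nhds_unique h1 ?_
  have p0 : (1 : ℝ) ≤ a 0 := by exact_mod_cast ha 0
  have := (cfValue_mem_Icc hs).1
  exact tendsto_const_nhds.div (tendsto_const_nhds.add (tendsto_cfValue hs)) (by positivity)

theorem cfValue_mem_Ioo {a : ℕ → ℕ} (ha : ∀ k, 1 ≤ a k) : cfValue a ∈ Set.Ioo (0 : ℝ) 1 := by
  have hs : ∀ k, 1 ≤ a (k + 1) := fun k => ha _
  have hpos : ∀ b : ℕ → ℕ, (∀ k, 1 ≤ b k) → 0 < cfValue b := by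
    intro b hb
    rw [cfValue_eq hb]
    have p0 : (1 : ℝ) ≤ b 0 := by exact_mod_cast hb 0
    have := (cfValue_mem_Icc (a := fun k => b (k + 1)) fun k => hb _).1
    positivity
  refine ⟨hpos a ha, ?_⟩
  rw [cfValue_eq ha]
  have p0 : (1 : ℝ) ≤ a 0 := by exact_mod_cast ha 0
  have := hpos _ hs
  rw [div_lt_one (by positivity)]
  linarith

theorem inv_cfValue {a : ℕ → ℕ} (ha : ∀ k, 1 ≤ a k) :
    (cfValue a)⁻¹ = a 0 + cfValue fun k => a (k + 1) := by
  rw [cfValue_eq ha, one_div, inv_inv]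

theorem gaussMap_cfValue {a : ℕ → ℕ} (ha : ∀ k, 1 ≤ a k) :
    gaussMap (cfValue a) = cfValue fun k => a (k + 1) := by
  have := cfValue_mem_Ioo (a := fun k => a (k + 1)) fun k => ha _
  rw [gaussMap, inv_cfValue ha, Int.fract_natCast_add, Int.fract_eq_self.2 ⟨this.1.le, this.2⟩]

theorem gaussMap_iterate_cfValue (n : ℕ) : ∀ {a : ℕ → ℕ}, (∀ k, 1 ≤ a k) →
    gaussMap^[n] (cfValue a) = cfValue fun k => a (k + n) := by
  induction n with
  | zero => intro a _; rfl
  | succ n ih =>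
    intro a ha
    rw [Function.iterate_succ_apply, gaussMap_cfValue ha, ih fun k => ha _]
    rfl

theorem partialQuotient_cfValue {a : ℕ → ℕ} (ha : ∀ k, 1 ≤ a k) (n : ℕ) :
    partialQuotient (cfValue a) n = a n := by
  have := cfValue_mem_Ioo (a := fun k => a (k + 1 + n)) fun k => ha _
  rw [partialQuotient, gaussMap_iterate_cfValue n ha, inv_cfValue fun k => ha _, add_comm,
    Nat.floor_add_natCast this.1.le, Nat.floor_eq_zero.2 this.2]
  simp

/-- Descent on the denominator: if the value is p/q, then p < q and the shifted fraction equals (q -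
a₀p)/p, with the smaller denominator p. -/
theorem irrational_cfValue {a : ℕ → ℕ} (ha : ∀ k, 1 ≤ a k) : Irrational (cfValue a) := by
  have key : ∀ q : ℕ, ∀ p : ℕ, ∀ a : ℕ → ℕ, (∀ k, 1 ≤ a k) → cfValue a ≠ (p : ℝ) / q := by
    intro q
    induction q using Nat.strong_induction_on with
    | _ q ih =>
      intro p a ha h
      have hm := cfValue_mem_Ioo ha
      have hi := inv_cfValue ha
      rw [h] at hm hi
      have hq : (0 : ℝ) < q := by
        rcases Nat.eq_zero_or_pos q with rfl | hq
        · simp at hm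
        · exact_mod_cast hq
      have hp : (0 : ℝ) < p := (div_pos_iff_of_pos_right hq).1 hm.1
      have hpq : p < q := by exact_mod_cast (div_lt_one hq).1 hm.2
      have h0 := (cfValue_mem_Ioo (a := fun k => a (k + 1)) fun k => ha _).1
      have e : (cfValue fun k => a (k + 1)) * p = q - a 0 * p := by
        rw [inv_div, div_eq_iff hp.ne'] at hi
        rw [hi]; ring
      have hle : a 0 * p ≤ q := by
        have : (a 0 : ℝ) * p ≤ q := by nlinarith
        exact_mod_cast this
      refine ih p hpq (q - a 0 * p) (fun k => a (k + 1)) (fun k => ha _) ?_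
      rw [eq_div_iff hp.ne', e]
      push_cast [hle]
      ring
  rintro ⟨x, hx⟩
  have h0 := (cfValue_mem_Ioo ha).1
  refine key x.den x.num.toNat a ha ?_
  rw [← hx]
  have : 0 < x := by exact_mod_cast hx ▸ h0
  have hn : ((x.num.toNat : ℤ) : ℝ) = x.num := by
    rw [Int.toNat_of_nonneg (Rat.num_pos.2 this).le]
  rw [← Int.cast_natCast x.num.toNat, hn]
  exact Rat.cast_def x

/-! ### Cylinder lengths and separation of points. -/

/-- The quotient `q_{n-1} / q_n` of consecutive continuants of a sequence of partial quotients. -/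
def theta (a : ℕ → ℕ) : ℕ → ℝ
  | 0 => 0
  | n + 1 => 1 / (a n + theta a n)

/-- The length of the cylinder of `w` followed by `a`, relative to that of `w`, where `θ` is the
quotient of the last two continuants of `w`. -/
def ratio (θ : ℝ) (a : ℕ) : ℝ := (1 + θ) / ((a + θ) * (a + 1 + θ))

/-- The length of the cylinder of the first `n` partial quotients. -/
def cylLength (a : ℕ → ℕ) : ℕ → ℝ
  | 0 => 1
  | n + 1 => cylLength a n * ratio (theta a n) (a n)

theorem one_div_add_mem {θ : ℝ} (h : θ ∈ Set.Icc (0 : ℝ) 1) {a : ℕ} (ha : 1 ≤ a) :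
    1 / (a + θ) ∈ Set.Icc (0 : ℝ) 1 := by
  have h1 : (1 : ℝ) ≤ a := by exact_mod_cast ha
  have h0 := h.1
  exact ⟨by positivity, div_le_one_of_le₀ (by linarith) (by linarith)⟩

theorem theta_mem {a : ℕ → ℕ} (ha : ∀ k, 1 ≤ a k) (n : ℕ) : theta a n ∈ Set.Icc (0 : ℝ) 1 := by
  induction n with
  | zero => simp [theta]
  | succ n ih => exact one_div_add_mem ih (ha n)

theorem theta_congr {a b : ℕ → ℕ} {n : ℕ} (h : ∀ k < n, a k = b k) : theta a n = theta b n := by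
  induction n with
  | zero => rfl
  | succ n ih => rw [theta, theta, ih fun k hk => h k (by omega), h n (by omega)]

theorem ratio_pos {θ : ℝ} (h : 0 ≤ θ) {a : ℕ} (ha : 1 ≤ a) : 0 < ratio θ a := by
  have h1 : (1 : ℝ) ≤ a := by exact_mod_cast ha
  unfold ratio
  positivity

theorem ratio_le_one_div {θ : ℝ} (h : 0 ≤ θ) {a : ℕ} (ha : 1 ≤ a) : ratio θ a ≤ 1 / a := by
  have h1 : (1 : ℝ) ≤ a := by exact_mod_cast ha
  unfold ratio
  rw [div_le_div_iff₀ (by positivity) (by positivity)]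
  nlinarith [mul_nonneg h h, mul_nonneg h (sub_nonneg.2 h1)]

theorem ratio_le_half {θ : ℝ} (h : 0 ≤ θ) {a : ℕ} (ha : 1 ≤ a) : ratio θ a ≤ 1 / 2 := by
  have h1 : (1 : ℝ) ≤ a := by exact_mod_cast ha
  unfold ratio
  rw [div_le_div_iff₀ (by positivity) (by positivity)]
  nlinarith [mul_nonneg h h, mul_nonneg h (sub_nonneg.2 h1)]

theorem le_ratio {θ : ℝ} (h : θ ∈ Set.Icc (0 : ℝ) 1) {a : ℕ} (ha : 1 ≤ a) :
    1 / ((a + 1) * (a + 2) : ℝ) ≤ ratio θ a := by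
  have h1 : (1 : ℝ) ≤ a := by exact_mod_cast ha
  obtain ⟨h0, h2⟩ := h
  unfold ratio
  have h3 : ((a : ℝ) + θ) * (a + 1 + θ) ≤ (a + 1) * (a + 2) :=
    mul_le_mul (by linarith) (by linarith) (by linarith) (by linarith)
  exact div_le_div₀ (by positivity) (by linarith) (by positivity) h3

theorem cylLength_pos {a : ℕ → ℕ} (ha : ∀ k, 1 ≤ a k) (n : ℕ) : 0 < cylLength a n := by
  induction n with
  | zero => simp [cylLength]
  | succ n ih => exact mul_pos ih (ratio_pos (theta_mem ha n).1 (ha n))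

theorem cylLength_le {a : ℕ → ℕ} (ha : ∀ k, 1 ≤ a k) (n : ℕ) :
    cylLength a n ≤ (1 / 2) ^ n := by
  induction n with
  | zero => simp [cylLength]
  | succ n ih =>
    rw [pow_succ]
    exact mul_le_mul ih (ratio_le_half (theta_mem ha n).1 (ha n))
      (ratio_pos (theta_mem ha n).1 (ha n)).le (by positivity)

/-- The distance of two points of a cylinder in terms of their images under the Gauss map. -/
theorem abs_cfValue_sub {a b : ℕ → ℕ} (ha : ∀ k, 1 ≤ a k) (hb : ∀ k, 1 ≤ b k) {n : ℕ}
    (h : ∀ k < n, a k = b k) :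
    |cfValue a - cfValue b| = cylLength a n * (1 + theta a n) *
      |(cfValue fun k => a (k + n)) - cfValue fun k => b (k + n)| /
      ((1 + theta a n * cfValue fun k => a (k + n)) *
        (1 + theta a n * cfValue fun k => b (k + n))) := by
  induction n with
  | zero => simp [cylLength, theta]
  | succ n ih =>
    rw [ih fun k hk => h k (by omega)]
    have e1 : (cfValue fun k => a (k + n)) = 1 / (a n + cfValue fun k => a (k + (n + 1))) := by
      rw [cfValue_eq fun k => ha _, zero_add]
      simp only [add_right_comm, add_assoc]
    have e2 : (cfValue fun k => b (k + n)) = 1 / (a n + cfValue fun k => b (k + (n + 1))) := by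
      rw [cfValue_eq fun k => hb _, zero_add, h n (by omega)]
      simp only [add_right_comm, add_assoc]
    rw [e1, e2]
    have hu := (cfValue_mem_Ioo (a := fun k => a (k + (n + 1))) fun k => ha _).1
    have hv := (cfValue_mem_Ioo (a := fun k => b (k + (n + 1))) fun k => hb _).1
    set u := cfValue fun k => a (k + (n + 1))
    set v := cfValue fun k => b (k + (n + 1))
    have hθ := (theta_mem ha n).1
    have p0 : (1 : ℝ) ≤ a n := by exact_mod_cast ha n
    rw [abs_one_div_sub_one_div (by linarith) hu.le hv.le, cylLength, theta, ratio]
    set θ := theta a n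
    have q1 : 0 < (a n : ℝ) + θ := by linarith
    have q2 : 0 < (a n : ℝ) + 1 + θ := by linarith
    have q3 : 0 < (a n : ℝ) + u := by linarith
    have q4 : 0 < (a n : ℝ) + v := by linarith
    -- With θ' = 1/(a n + θ), the new denominators come from 1 + θ/(a n + u) = (a n + θ)(1 + θ'u)/(a
    -- n + u), and likewise for v.
    field_simp
    ring

theorem one_div_le_cfValue {a : ℕ → ℕ} (ha : ∀ k, 1 ≤ a k) {M : ℝ} (hM : (a 0 : ℝ) + 1 ≤ M) :
    1 / M ≤ cfValue a := by
  rw [cfValue_eq ha]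
  have h := cfValue_mem_Ioo (a := fun k => a (k + 1)) fun k => ha _
  have h1 := h.1
  have h2 := h.2
  have p0 : (1 : ℝ) ≤ a 0 := by exact_mod_cast ha 0
  gcongr
  linarith

/-- The reciprocals differ by (b₀ - a₀) + v - u > v, since u < 1. For consecutive digits nothing
better holds, so the gap depends on the next digit b₁ through v ≥ 1/(b₁ + 1); this is the role of
`M'`. -/
theorem le_abs_cfValue_sub_of_lt {a b : ℕ → ℕ} (ha : ∀ k, 1 ≤ a k) (hb : ∀ k, 1 ≤ b k)
    {M M' : ℝ} (h : a 0 < b 0) (hbM : (b 0 : ℝ) + 1 ≤ M) (hbM' : (b 1 : ℝ) + 1 ≤ M') :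
    1 / (M ^ 2 * M') ≤ |cfValue a - cfValue b| := by
  have hu := cfValue_mem_Ioo (a := fun k => a (k + 1)) fun k => ha _
  have hv := cfValue_mem_Ioo (a := fun k => b (k + 1)) fun k => hb _
  have hv' := one_div_le_cfValue (a := fun k => b (k + 1)) (fun k => hb _) hbM'
  rw [cfValue_eq ha, cfValue_eq hb]
  set u := cfValue fun k => a (k + 1)
  set v := cfValue fun k => b (k + 1)
  have p0 : (1 : ℝ) ≤ a 0 := by exact_mod_cast ha 0
  have hab : (a 0 : ℝ) + 1 ≤ b 0 := by exact_mod_cast h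
  have hM' : 0 < M' := by have : (0 : ℝ) ≤ b 1 := Nat.cast_nonneg _; linarith
  have q1 : 0 < (a 0 : ℝ) + u := by linarith [hu.1]
  have q2 : 0 < (b 0 : ℝ) + v := by linarith [hv.1]
  have q3 : (a 0 : ℝ) + u ≤ M := by linarith [hu.2]
  have q4 : (b 0 : ℝ) + v ≤ M := by linarith [hv.2]
  rw [div_sub_div _ _ q1.ne' q2.ne', abs_div, abs_of_pos (mul_pos q1 q2)]
  have e : 1 / M' ≤ |1 * ((b 0 : ℝ) + v) - (a 0 + u) * 1| :=
    le_trans (by linarith [hu.2]) (le_abs_self _)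
  have hM : 0 < M := by linarith
  calc 1 / (M ^ 2 * M') = 1 / M' / (M * M) := by field_simp
    _ ≤ _ := by gcongr

theorem le_abs_cfValue_sub_of_ne {a b : ℕ → ℕ} (ha : ∀ k, 1 ≤ a k) (hb : ∀ k, 1 ≤ b k)
    {M M' : ℝ} (h : a 0 ≠ b 0) (haM : (a 0 : ℝ) + 1 ≤ M) (haM' : (a 1 : ℝ) + 1 ≤ M')
    (hbM : (b 0 : ℝ) + 1 ≤ M) (hbM' : (b 1 : ℝ) + 1 ≤ M') :
    1 / (M ^ 2 * M') ≤ |cfValue a - cfValue b| := by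
  rcases h.lt_or_gt with h | h
  · exact le_abs_cfValue_sub_of_lt ha hb h hbM hbM'
  · rw [abs_sub_comm]
    exact le_abs_cfValue_sub_of_lt hb ha h haM haM'

/-- Points that separate at level n are separated at the scale of their common cylinder: the
distortion factor (1 + θ)/((1 + θu)(1 + θv)) is at least 1/2, and the tails are apart by the
previous lemma. -/
theorem cylLength_le_abs_cfValue_sub {a b : ℕ → ℕ} (ha : ∀ k, 1 ≤ a k) (hb : ∀ k, 1 ≤ b k)
    {n : ℕ} (h : ∀ k < n, a k = b k) (hn : a n ≠ b n) {M M' : ℝ}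
    (haM : (a n : ℝ) + 1 ≤ M) (haM' : (a (n + 1) : ℝ) + 1 ≤ M')
    (hbM : (b n : ℝ) + 1 ≤ M) (hbM' : (b (n + 1) : ℝ) + 1 ≤ M') :
    cylLength a n ≤ 2 * (M ^ 2 * M') * |cfValue a - cfValue b| := by
  have key := le_abs_cfValue_sub_of_ne (a := fun k => a (k + n)) (b := fun k => b (k + n))
    (fun k => ha _) (fun k => hb _) (M := M) (M' := M') (by simpa using hn) (by simpa using haM)
    (by simpa [add_comm] using haM') (by simpa using hbM) (by simpa [add_comm] using hbM')
  rw [abs_cfValue_sub ha hb h]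
  have hu := cfValue_mem_Ioo (a := fun k => a (k + n)) fun k => ha _
  have hv := cfValue_mem_Ioo (a := fun k => b (k + n)) fun k => hb _
  set u := cfValue fun k => a (k + n)
  set v := cfValue fun k => b (k + n)
  have hθ := theta_mem ha n
  set θ := theta a n
  have hl := cylLength_pos ha n
  have hM : 0 < M := by have : (0 : ℝ) ≤ a n := Nat.cast_nonneg _; linarith
  have hM' : 0 < M' := by have : (0 : ℝ) ≤ a (n + 1) := Nat.cast_nonneg _; linarith
  rw [div_le_iff₀ (by positivity)] at key
  have k1 : θ * u ≤ θ := mul_le_of_le_one_right hθ.1 hu.2.le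
  have k2 : θ * v ≤ 1 := mul_le_one₀ hθ.2 hv.1.le hv.2.le
  have k3 : 0 ≤ θ * u := mul_nonneg hθ.1 hu.1.le
  have k4 : 0 ≤ θ * v := mul_nonneg hθ.1 hv.1.le
  have k5 : (1 + θ * u) * (1 + θ * v) ≤ (1 + θ) * 2 := by gcongr <;> linarith
  have k6 : 0 < (1 + θ * u) * (1 + θ * v) := by positivity
  rw [← mul_div_assoc, le_div_iff₀ k6]
  calc cylLength a n * ((1 + θ * u) * (1 + θ * v))
      ≤ cylLength a n * ((1 + θ) * 2) * 1 := by rw [mul_one]; gcongr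
    _ ≤ cylLength a n * ((1 + θ) * 2) * (|u - v| * (M ^ 2 * M')) := by
        have := hθ.1
        gcongr
    _ = _ := by ring

/-! ### Coding and the general lower bound for the dimension. -/

/-- Numbers of `[0, 1)` are coded by sequences of digits in such a way that the size of the sets of
numbers with given first digits is controlled by the lengths of the cylinders. -/
theorem exists_coding {D : ℕ → Finset ℕ} {c : ℕ → ℝ} {s : ℝ} (h1 : ∀ n, ∀ a ∈ D n, 1 ≤ a)
    (hc : ∀ n, 0 < c n)
    (hsum : ∀ n, ∀ θ ∈ Set.Icc (0 : ℝ) 1, 1 ≤ c n * ∑ a ∈ D n, ratio θ a ^ s) :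
    ∃ code : ℝ → ℕ → ℕ, ∀ t ∈ Set.Ico (0 : ℝ) 1, (∀ k, code t k ∈ D k) ∧
      ∀ t' ∈ Set.Ico (0 : ℝ) 1, ∀ n, (∀ k < n, code t k = code t' k) →
        |t - t'| ≤ (∏ i ∈ Finset.range n, c i) * cylLength (code t) n ^ s := by
  -- Tiles of length c_n · ratio^s cover [0, 1); `d t` is the digit of a tile containing t and `S`
  -- gives left endpoints. Tiles may overshoot 1, which does no harm.
  have H : ∀ n θ, ∃ S : ℕ → ℝ, ∃ d : ℝ → ℕ, θ ∈ Set.Icc (0 : ℝ) 1 → ∀ t ∈ Set.Ico (0 : ℝ) 1,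
      d t ∈ D n ∧ (t - S (d t)) / (c n * ratio θ (d t) ^ s) ∈ Set.Ico (0 : ℝ) 1 := by
    intro n θ
    obtain ⟨S, hS⟩ := exists_tiling (D n) fun a => c n * ratio θ a ^ s
    by_cases hθ : θ ∈ Set.Icc (0 : ℝ) 1
    · have : ∀ t, ∃ a, t ∈ Set.Ico (0 : ℝ) 1 →
          a ∈ D n ∧ S a ≤ t ∧ t < S a + c n * ratio θ a ^ s := by
        intro t
        by_cases ht : t ∈ Set.Ico (0 : ℝ) 1
        · obtain ⟨a, h⟩ := hS t ht.1 (ht.2.trans_le (by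
            rw [← Finset.mul_sum]; exact hsum n θ hθ))
          exact ⟨a, fun _ => h⟩
        · exact ⟨0, fun h => absurd h ht⟩
      choose d hd using this
      refine ⟨S, d, fun _ t ht => ?_⟩
      obtain ⟨e1, e2, e3⟩ := hd t ht
      have : 0 < c n * ratio θ (d t) ^ s :=
        mul_pos (hc n) (Real.rpow_pos_of_pos (ratio_pos hθ.1 (h1 n _ e1)) s)
      exact ⟨e1, div_nonneg (by linarith) this.le, by rw [div_lt_one this]; linarith⟩
    · exact ⟨S, fun _ => 0, fun h => absurd h hθ⟩
  choose S d hd using H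
  -- The state is the position inside the current tile, rescaled to [0, 1), together with the
  -- current value of `theta`.
  let next : ℕ → ℝ × ℝ → ℝ × ℝ := fun n p =>
    ((p.1 - S n p.2 (d n p.2 p.1)) / (c n * ratio p.2 (d n p.2 p.1) ^ s),
      1 / (d n p.2 p.1 + p.2))
  let st : ℝ → ℕ → ℝ × ℝ := fun t n => Nat.rec (t, 0) next n
  let code : ℝ → ℕ → ℕ := fun t n => d n (st t n).2 (st t n).1
  have hst : ∀ t ∈ Set.Ico (0 : ℝ) 1, ∀ n,
      (st t n).1 ∈ Set.Ico (0 : ℝ) 1 ∧ (st t n).2 ∈ Set.Icc (0 : ℝ) 1 := by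
    intro t ht n
    induction n with
    | zero => exact ⟨ht, by simp [st]⟩
    | succ n ih =>
      have := hd n _ ih.2 _ ih.1
      exact ⟨this.2, one_div_add_mem ih.2 (h1 n _ this.1)⟩
  have hcode : ∀ t ∈ Set.Ico (0 : ℝ) 1, ∀ k, code t k ∈ D k := fun t ht k =>
    (hd k _ (hst t ht k).2 _ (hst t ht k).1).1
  have hθ : ∀ t n, (st t n).2 = theta (code t) n := by
    intro t n
    induction n with
    | zero => rfl
    | succ n ih => rw [theta, ← ih]
  refine ⟨code, fun t ht => ⟨hcode t ht, fun t' ht' n hn => ?_⟩⟩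
  have hp : ∀ k, 1 ≤ code t k := fun k => h1 k _ (hcode t ht k)
  -- As long as the digits agree, both points undergo the same affine rescaling, so the identity is
  -- exact.
  have key : |t - t'| = (∏ i ∈ Finset.range n, c i) * cylLength (code t) n ^ s *
      |(st t n).1 - (st t' n).1| := by
    induction n with
    | zero => simp [st, cylLength]
    | succ n ih =>
      rw [ih fun k hk => hn k (by omega)]
      have e : code t n = code t' n := hn n (by omega)
      have eθ : theta (code t) n = theta (code t') n := theta_congr fun k hk => hn k (by omega)
      have r1 : (st t (n + 1)).1 = ((st t n).1 - S n (theta (code t) n) (code t n)) /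
          (c n * ratio (theta (code t) n) (code t n) ^ s) := by rw [← hθ]
      have r2 : (st t' (n + 1)).1 = ((st t' n).1 - S n (theta (code t) n) (code t n)) /
          (c n * ratio (theta (code t) n) (code t n) ^ s) := by rw [eθ, e, ← hθ]
      have hr := ratio_pos (theta_mem hp n).1 (hp n)
      have hpos : 0 < c n * ratio (theta (code t) n) (code t n) ^ s :=
        mul_pos (hc n) (Real.rpow_pos_of_pos hr s)
      rw [r1, r2, ← sub_div, abs_div, abs_of_pos hpos, sub_sub_sub_cancel_right,
        Finset.prod_range_succ, cylLength, Real.mul_rpow (cylLength_pos hp n).le hr.le]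
      have := (hc n).ne'
      field_simp
  rw [key]
  refine mul_le_of_le_one_right ?_ ?_
  · exact mul_nonneg (Finset.prod_nonneg fun i _ => (hc i).le)
      (Real.rpow_nonneg (cylLength_pos hp n).le s)
  · have u1 := (hst t ht n).1
    have u2 := (hst t' ht' n).1
    rw [abs_le]
    exact ⟨by linarith [u1.1, u2.2], by linarith [u1.2, u2.1]⟩

/-- A lower bound for the dimension of sets of continued fractions with prescribed sets of
partial quotients. -/
theorem le_dimH_of_digits {X : Set ℝ} {D : ℕ → Finset ℕ} {c M : ℕ → ℝ} {s : ℝ} (hs : 0 < s)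
    (h1 : ∀ n, ∀ a ∈ D n, 1 ≤ a) (hM : ∀ n, ∀ a ∈ D n, (a : ℝ) + 1 ≤ M n) (hc : ∀ n, 0 < c n)
    (hsum : ∀ n, ∀ θ ∈ Set.Icc (0 : ℝ) 1, 1 ≤ c n * ∑ a ∈ D n, ratio θ a ^ s)
    (hgrow : ∀ ε : ℝ, 0 < ε → ∃ K : ℝ, ∀ a : ℕ → ℕ, (∀ k, a k ∈ D k) → ∀ n,
      (∏ i ∈ Finset.range n, c i) * cylLength a n ^ ε ≤ K)
    (hgrow' : ∀ ε : ℝ, 0 < ε → ∃ K : ℝ, ∀ a : ℕ → ℕ, (∀ k, a k ∈ D k) → ∀ n,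
      M n ^ 2 * M (n + 1) * cylLength a n ^ ε ≤ K)
    (hX : ∀ a : ℕ → ℕ, (∀ k, a k ∈ D k) → cfValue a ∈ X) : ENNReal.ofReal s ≤ dimH X := by
  obtain ⟨code, hcode⟩ := exists_coding h1 hc hsum
  -- One ε is spent on ∏ c_i (numerator), another on the separation constants M n ^ 2 * M (n + 1)
  -- (denominator).
  have key : ∀ ε, 0 < ε → ε < s → ENNReal.ofReal ((s - ε) / (1 + ε)) ≤ dimH X := by
    intro ε hε hεs
    obtain ⟨K₁, hK₁⟩ := hgrow ε hε
    obtain ⟨K₂, hK₂⟩ := hgrow' ε hε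
    have hr : 0 < (s - ε) / (1 + ε) := div_pos (by linarith) (by linarith)
    have hφ : ∀ t ∈ Set.Ico (0 : ℝ) 1, ∀ t' ∈ Set.Ico (0 : ℝ) 1, dist t t' ≤
        |K₁| * (2 * |K₂|) ^ ((s - ε) / (1 + ε)) *
          dist (cfValue (code t)) (cfValue (code t')) ^ ((s - ε) / (1 + ε)) := by
      intro t ht t' ht'
      obtain ⟨hd, hd2⟩ := hcode t ht
      obtain ⟨hd', -⟩ := hcode t' ht'
      have hp : ∀ k, 1 ≤ code t k := fun k => h1 k _ (hd k)
      have hp' : ∀ k, 1 ≤ code t' k := fun k => h1 k _ (hd' k)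
      have hbd : ∀ n, (∀ k < n, code t k = code t' k) →
          |t - t'| ≤ |K₁| * cylLength (code t) n ^ (s - ε) := by
        intro n hn
        have hl := cylLength_pos hp n
        calc |t - t'| ≤ (∏ i ∈ Finset.range n, c i) * cylLength (code t) n ^ s := hd2 t' ht' n hn
          _ = (∏ i ∈ Finset.range n, c i) * cylLength (code t) n ^ ε *
              cylLength (code t) n ^ (s - ε) := by
            rw [mul_assoc, ← Real.rpow_add hl, add_sub_cancel]
          _ ≤ _ := by
            gcongr
            exact (hK₁ _ hd n).trans (le_abs_self _)
      -- If all digits agree, the bound tends to 0 and t = t'; otherwise the first disagreement n is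
      -- used for both estimates.
      by_cases hall : ∀ k, code t k = code t' k
      · have hlim : Tendsto (fun n => |K₁| * cylLength (code t) n ^ (s - ε)) atTop
            (𝓝 (|K₁| * 0 ^ (s - ε))) := by
          refine Tendsto.const_mul _ ?_
          refine Tendsto.rpow_const ?_ (Or.inr (by linarith))
          exact squeeze_zero (fun n => (cylLength_pos hp n).le) (cylLength_le hp)
            (tendsto_pow_atTop_nhds_zero_of_lt_one (by norm_num) (by norm_num))
        rw [Real.zero_rpow (by linarith), mul_zero] at hlim
        have := ge_of_tendsto' hlim fun n => hbd n fun k _ => hall k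
        rw [Real.dist_eq]
        exact this.trans (by positivity)
      · push Not at hall
        classical
        set n := Nat.find hall
        have hn : code t n ≠ code t' n := Nat.find_spec hall
        have hlt : ∀ k < n, code t k = code t' k := fun k hk => by
          simpa using Nat.find_min hall hk
        have hl := cylLength_pos hp n
        have hm1 : 0 < M n := by
          have := hM n _ (hd n)
          have : (0 : ℝ) ≤ code t n := Nat.cast_nonneg _
          linarith
        have hm2 : 0 < M (n + 1) := by
          have := hM (n + 1) _ (hd (n + 1))
          have : (0 : ℝ) ≤ code t (n + 1) := Nat.cast_nonneg _
          linarith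
        have hdist := cylLength_le_abs_cfValue_sub hp hp' hlt hn (hM n _ (hd n))
          (hM _ _ (hd (n + 1))) (hM n _ (hd' n)) (hM _ _ (hd' (n + 1)))
        have h2 : cylLength (code t) n ^ (1 + ε) ≤
            2 * |K₂| * |cfValue (code t) - cfValue (code t')| := by
          rw [Real.rpow_add hl, Real.rpow_one]
          calc _ ≤ 2 * (M n ^ 2 * M (n + 1)) * |cfValue (code t) - cfValue (code t')| *
                cylLength (code t) n ^ ε := by gcongr
            _ = 2 * (M n ^ 2 * M (n + 1) * cylLength (code t) n ^ ε) *
                |cfValue (code t) - cfValue (code t')| := by ring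
            _ ≤ _ := by
              gcongr
              exact (hK₂ _ hd n).trans (le_abs_self _)
        rw [Real.dist_eq, Real.dist_eq, mul_assoc,
          ← Real.mul_rpow (by positivity) (abs_nonneg _)]
        refine (hbd n hlt).trans ?_
        gcongr
        calc cylLength (code t) n ^ (s - ε)
            = (cylLength (code t) n ^ (1 + ε)) ^ ((s - ε) / (1 + ε)) := by
              rw [← Real.rpow_mul hl.le]
              congr 1
              field_simp
          _ ≤ _ := by gcongr
    have := le_dimH_of_le_dist_rpow (X := X) (φ := fun t => cfValue (code t))
      (K := (|K₁| * (2 * |K₂|) ^ ((s - ε) / (1 + ε))).toNNReal)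
      (r := ((s - ε) / (1 + ε)).toNNReal) (by simpa using hr)
      (fun t ht => hX _ (hcode t ht).1) (by
        rw [Real.coe_toNNReal _ (by positivity), Real.coe_toNNReal _ hr.le]
        exact hφ)
    exact this
  have hcont : Tendsto (fun ε : ℝ => ENNReal.ofReal ((s - ε) / (1 + ε))) (𝓝[>] 0)
      (𝓝 (ENNReal.ofReal s)) := by
    have : ContinuousAt (fun ε : ℝ => (s - ε) / (1 + ε)) 0 :=
      ContinuousAt.div (by fun_prop) (by fun_prop) (by norm_num)
    have h := (ENNReal.continuous_ofReal.continuousAt.comp this).tendsto.mono_left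
      (nhdsWithin_le_nhds (s := Set.Ioi 0))
    simpa [Function.comp_def] using h
  refine le_of_tendsto hcont ?_
  filter_upwards [Ioo_mem_nhdsGT hs] with ε hε
  exact key ε hε.1 hε.2

/-! ### Digit sequences with a prescribed number of distinct values. -/

theorem F_eq (c : ℝ) : F c = E 1 c := by
  simp [F, E]

/-- Digits that are at most `N`, except at the times at which the counting function `f` increases:
there the digits lie in disjoint blocks bounded by the values of `L`. -/
def blockDigits (N : ℕ) (L f : ℕ → ℕ) (n : ℕ) : Finset ℕ :=
  if f (n + 1) = f n then Finset.Icc 1 N else Finset.Ico (L (f n)) (L (f n + 1))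

section Block

variable {N : ℕ} {L f a : ℕ → ℕ}

/-- The bound by `L (f n)` is the induction invariant: it makes every digit of the next block larger
than all earlier ones, hence new. -/
theorem card_filter_image_blockDigits (hL : StrictMono L) (hN : N < L 0) (hf0 : f 0 = 0)
    (hf : ∀ n, f (n + 1) = f n ∨ f (n + 1) = f n + 1) (ha : ∀ k, a k ∈ blockDigits N L f k)
    (n : ℕ) :
    (((Finset.range n).image a).filter (N < ·)).card = f n ∧
      ∀ x ∈ (Finset.range n).image a, x < L (f n) := by
  induction n with
  | zero => simp [hf0]
  | succ n ih =>
    obtain ⟨ih1, ih2⟩ := ih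
    have hn := ha n
    rw [Finset.range_add_one, Finset.image_insert]
    rcases hf n with h | h
    · rw [blockDigits, if_pos h, Finset.mem_Icc] at hn
      rw [Finset.filter_insert, if_neg (by omega), h]
      refine ⟨ih1, fun x hx => ?_⟩
      rcases Finset.mem_insert.1 hx with rfl | hx
      · exact (hn.2.trans_lt hN).trans_le (hL.monotone (Nat.zero_le _))
      · exact ih2 x hx
    · rw [blockDigits, if_neg (by omega), Finset.mem_Ico] at hn
      have hlt : N < a n := hN.trans_le ((hL.monotone (Nat.zero_le _)).trans hn.1)
      rw [Finset.filter_insert, if_pos hlt, h, Finset.card_insert_of_notMem, ih1]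
      · refine ⟨rfl, fun x hx => ?_⟩
        rcases Finset.mem_insert.1 hx with rfl | hx
        · exact hn.2
        · exact (ih2 x hx).trans (hL (Nat.lt_succ_self _))
      · intro hmem
        have := ih2 _ (Finset.mem_filter.1 hmem).1
        omega

theorem one_le_of_mem_blockDigits (hL : StrictMono L) (hN : N < L 0) {n x : ℕ}
    (hx : x ∈ blockDigits N L f n) : 1 ≤ x := by
  unfold blockDigits at hx
  split_ifs at hx with h
  · exact (Finset.mem_Icc.1 hx).1
  · have := hL.monotone (Nat.zero_le (f n))
    have := (Finset.mem_Ico.1 hx).1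
    omega

/-- Digits above N contribute exactly f(n) values and the others at most N + 1, a bounded error that
is negligible against n^β. -/
theorem cfValue_mem_E (hL : StrictMono L) (hN : N < L 0) (hf0 : f 0 = 0)
    (hf : ∀ n, f (n + 1) = f n ∨ f (n + 1) = f n + 1) {β c C : ℝ} (hβ : 0 < β)
    (hfc : ∀ n : ℕ, |(f n : ℝ) - c * (n : ℝ) ^ β| ≤ C) (ha : ∀ k, a k ∈ blockDigits N L f k) :
    cfValue a ∈ E β c := by
  have hp : ∀ k, 1 ≤ a k := fun k => one_le_of_mem_blockDigits hL hN (ha k)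
  refine ⟨cfValue_mem_Ioo hp, irrational_cfValue hp, ?_⟩
  have hR : ∀ n, |(R n (cfValue a) : ℝ) - c * (n : ℝ) ^ β| ≤ C + (N + 1) := by
    intro n
    have e : R n (cfValue a) = ((Finset.range n).image a).card := by
      rw [R, funext (partialQuotient_cfValue hp)]
    have h1 := (card_filter_image_blockDigits hL hN hf0 hf ha n).1
    have h2 := Finset.card_filter_add_card_filter_not (s := (Finset.range n).image a) (N < ·)
    have h3 : (((Finset.range n).image a).filter (¬ N < ·)).card ≤ N + 1 := by
      calc _ ≤ (Finset.range (N + 1)).card := by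
            refine Finset.card_le_card fun x hx => ?_
            have := (Finset.mem_filter.1 hx).2
            exact Finset.mem_range.2 (by omega)
        _ = N + 1 := Finset.card_range _
    rw [h1, ← e] at h2
    have h4 : (R n (cfValue a) : ℝ) ≤ f n + (N + 1) := by exact_mod_cast (by omega)
    have h5 : (f n : ℝ) ≤ R n (cfValue a) := by exact_mod_cast (by omega)
    have h6 := abs_le.1 (hfc n)
    rw [abs_le]
    constructor <;> linarith
  have hz : Tendsto (fun n : ℕ => ((R n (cfValue a) : ℝ) - c * (n : ℝ) ^ β) / (n : ℝ) ^ β) atTop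
      (𝓝 0) := by
    have hpow : Tendsto (fun n : ℕ => (n : ℝ) ^ β) atTop atTop :=
      (tendsto_rpow_atTop hβ).comp tendsto_natCast_atTop_atTop
    refine squeeze_zero_norm (fun n => ?_) (hpow.const_div_atTop (C + (N + 1)))
    rw [Real.norm_eq_abs, abs_div, abs_of_nonneg (Real.rpow_nonneg (Nat.cast_nonneg n) β)]
    have := hR n
    gcongr
  have := hz.add_const c
  rw [zero_add] at this
  refine this.congr' ?_
  filter_upwards [eventually_gt_atTop 0] with n hn
  have : (0 : ℝ) < (n : ℝ) ^ β := Real.rpow_pos_of_pos (by exact_mod_cast hn) β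
  field_simp
  ring

end Block

theorem rpow_add_one_le {β : ℝ} (h0 : 0 ≤ β) (h1 : β ≤ 1) {x : ℝ} (hx : 0 < x) :
    (x + 1) ^ β ≤ x ^ β + β * x ^ (β - 1) := by
  have h : 0 ≤ 1 / x := by positivity
  have := rpow_one_add_le_one_add_mul_self (s := 1 / x) (p := β) (by linarith) h0 h1
  calc (x + 1) ^ β = x ^ β * (1 + 1 / x) ^ β := by
        rw [← Real.mul_rpow hx.le (by positivity)]; congr 1; field_simp
    _ ≤ x ^ β * (1 + β * (1 / x)) := by gcongr
    _ = _ := by rw [Real.rpow_sub_one hx.ne']; field_simp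

/-- A counting function within a bounded distance of `c * n ^ β`. -/
theorem exists_counting {β c : ℝ} (h0 : 0 < β) (h1 : β ≤ 1) (hc : 0 < c) (h : β = 1 → c ≤ 1) :
    ∃ f : ℕ → ℕ, f 0 = 0 ∧ (∀ n, f (n + 1) = f n ∨ f (n + 1) = f n + 1) ∧
      ∃ C, ∀ n : ℕ, |(f n : ℝ) - c * (n : ℝ) ^ β| ≤ C := by
  -- From some m on, c n^β grows by at most 1 per step, so its floor does too: for β = 1 because c ≤
  -- 1, for β < 1 because the derivative tends to 0.
  obtain ⟨m, hm⟩ : ∃ m : ℕ, ∀ n ≥ m, c * ((n + 1 : ℕ) : ℝ) ^ β ≤ c * (n : ℝ) ^ β + 1 := by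
    rcases h1.eq_or_lt with rfl | h1
    · refine ⟨0, fun n _ => ?_⟩
      have := h rfl
      simp only [Real.rpow_one]
      push_cast
      linarith
    · have ht : Tendsto (fun n : ℕ => c * (β * (n : ℝ) ^ (β - 1))) atTop (𝓝 (c * (β * 0))) := by
        refine Tendsto.const_mul _ (Tendsto.const_mul _ ?_)
        have := (tendsto_rpow_neg_atTop (y := 1 - β) (by linarith)).comp
          tendsto_natCast_atTop_atTop
        simpa [Function.comp_def] using this
      rw [mul_zero, mul_zero] at ht
      obtain ⟨m, hm⟩ := eventually_atTop.1
        ((ht.eventually_le_const zero_lt_one).and (eventually_gt_atTop 0))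
      refine ⟨m, fun n hn => ?_⟩
      obtain ⟨e1, e2⟩ := hm n hn
      have := rpow_add_one_le h0.le h1.le (x := n) (by exact_mod_cast e2)
      push_cast
      nlinarith
  set g : ℕ → ℝ := fun n => c * (n : ℝ) ^ β with hg
  have hg0 : ∀ n, 0 ≤ g n := fun n => by positivity
  have gmono : Monotone g := fun i j hij => by
    have : (i : ℝ) ≤ j := by exact_mod_cast hij
    simp only [hg]
    gcongr
  have fmono : ∀ {i j}, i ≤ j → ⌊g i⌋₊ ≤ ⌊g j⌋₊ := fun hij => Nat.floor_mono (gmono hij)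
  -- Freezing the floor before m and subtracting its value there gives f 0 = 0 at the price of a
  -- bounded error.
  refine ⟨fun n => ⌊g (max n m)⌋₊ - ⌊g m⌋₊, by simp, fun n => ?_, 1 + g m, fun n => ?_⟩
  · rcases lt_or_ge n m with hn | hn
    · left
      simp only [max_eq_right hn.le, max_eq_right (Nat.succ_le_of_lt hn)]
    · simp only [max_eq_left hn, max_eq_left (by omega : m ≤ n + 1)]
      have e1 := fmono hn
      have e2 := fmono (Nat.le_add_right n 1)
      have e3 : ⌊g (n + 1)⌋₊ ≤ ⌊g n⌋₊ + 1 := by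
        rw [← Nat.floor_add_one (hg0 n)]
        exact Nat.floor_mono (hm n hn)
      omega
  · have hgm := hg0 m
    rcases lt_or_ge n m with hn | hn
    · simp only [max_eq_right hn.le, Nat.sub_self, Nat.cast_zero, zero_sub, abs_neg]
      rw [abs_of_nonneg (hg0 n)]
      exact (gmono hn.le).trans (by linarith)
    · simp only [max_eq_left hn]
      rw [Nat.cast_sub (fmono hn)]
      have e1 := Nat.floor_le (hg0 n)
      have e2 := Nat.lt_floor_add_one (g n)
      have e3 := Nat.floor_le (hg0 m)
      have e4 : (0 : ℝ) ≤ ⌊g m⌋₊ := Nat.cast_nonneg _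
      simp only [hg] at *
      rw [abs_le]
      constructor <;> linarith

/-! ### Lower bound for `F c`. -/

/-- The step from f to f + 1 has a digit at least 2^(f+1), which multiplies the squared length by at
most 2^(-2(f+1)), and f² + 2(f + 1) ≥ (f + 1)². Squaring avoids half-integral exponents. -/
theorem cylLength_sq_le {f a : ℕ → ℕ} (hf0 : f 0 = 0)
    (hf : ∀ n, f (n + 1) = f n ∨ f (n + 1) = f n + 1) (hp : ∀ k, 1 ≤ a k)
    (ha : ∀ k, a k ∈ blockDigits 1 (fun k => 2 ^ (k + 1)) f k) (n : ℕ) :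
    cylLength a n ^ 2 ≤ (1 / 2) ^ (f n ^ 2) := by
  induction n with
  | zero => simp [cylLength, hf0]
  | succ n ih =>
    have h0 := cylLength_pos hp n
    have hθ := (theta_mem hp n).1
    have hr := ratio_pos hθ (hp n)
    rw [cylLength, mul_pow]
    have hn := ha n
    rcases hf n with h | h
    · rw [h]
      have := ratio_le_half hθ (hp n)
      refine (mul_le_of_le_one_right (by positivity) (pow_le_one₀ hr.le (by linarith))).trans ih
    · rw [blockDigits, if_neg (by omega), Finset.mem_Ico] at hn
      have h1 : (2 : ℝ) ^ (f n + 1) ≤ a n := by exact_mod_cast hn.1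
      have h2 : ratio (theta a n) (a n) ≤ (1 / 2) ^ (f n + 1) := by
        refine (ratio_le_one_div hθ (hp n)).trans ?_
        rw [one_div_pow]
        gcongr
      calc _ ≤ (1 / 2 : ℝ) ^ (f n ^ 2) * ((1 / 2) ^ (f n + 1)) ^ 2 := by gcongr
        _ = (1 / 2 : ℝ) ^ (f n ^ 2 + (f n + 1) * 2) := by rw [← pow_mul, ← pow_add]
        _ ≤ _ := pow_le_pow_of_le_one (by norm_num) (by norm_num) (by rw [h]; nlinarith)

/-- Quantities that grow exponentially are negligible against ones that decay like `2 ^ (-x ^ 2)`. -/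
theorem exists_two_rpow_mul_le {A B ε : ℝ} (hε : 0 < ε) : ∃ K : ℝ, ∀ (m : ℕ) (l : ℝ), 0 < l →
    l ^ 2 ≤ (1 / 2) ^ (m ^ 2) → (2 : ℝ) ^ (A * m + B) * l ^ ε ≤ K := by
  -- The exponent is the maximum of Ax + B - εx²/2, attained at x = A/ε.
  refine ⟨2 ^ (B + A ^ 2 / (2 * ε)), fun m l hl h => ?_⟩
  have h1 : l ^ ε ≤ (2 : ℝ) ^ (-(ε / 2 * (m : ℝ) ^ 2)) := by
    calc l ^ ε = (l ^ 2) ^ (ε / 2) := by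
          rw [← Real.rpow_natCast, ← Real.rpow_mul hl.le]; congr 1; push_cast; ring
      _ ≤ ((1 / 2 : ℝ) ^ (m ^ 2)) ^ (ε / 2) := by gcongr
      _ = _ := by
        rw [one_div, inv_pow, ← Real.rpow_natCast, ← Real.rpow_neg (by norm_num),
          ← Real.rpow_mul (by norm_num)]
        congr 1
        push_cast
        ring
  calc (2 : ℝ) ^ (A * m + B) * l ^ ε ≤ 2 ^ (A * m + B) * 2 ^ (-(ε / 2 * (m : ℝ) ^ 2)) := by gcongr
    _ = 2 ^ (A * m + B + -(ε / 2 * (m : ℝ) ^ 2)) := by rw [← Real.rpow_add (by norm_num)]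
    _ ≤ _ := by
      refine Real.rpow_le_rpow_of_exponent_le (by norm_num) ?_
      have e : B + A ^ 2 / (2 * ε) - (A * m + B + -(ε / 2 * (m : ℝ) ^ 2))
          = (A - ε * m) ^ 2 / (2 * ε) := by field_simp; ring
      have : 0 ≤ (A - ε * m) ^ 2 / (2 * ε) := by positivity
      linarith

/-- The set `F(c)` has dimension at least `1/2`. -/
theorem half_le_dimH_F {c : ℝ} (hc : 0 < c) (hc1 : c ≤ 1) : 1 / 2 ≤ dimH (F c) := by
  obtain ⟨f, hf0, hf, C, hC⟩ := exists_counting one_pos le_rfl hc fun _ => hc1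
  have hL : StrictMono fun k : ℕ => 2 ^ (k + 1) := fun i j hij =>
    Nat.pow_lt_pow_right (by norm_num) (by omega)
  have hN : 1 < 2 ^ (0 + 1) := by norm_num
  have h1 : ∀ n, ∀ a ∈ blockDigits 1 (fun k => 2 ^ (k + 1)) f n, 1 ≤ a := fun n a h =>
    one_le_of_mem_blockDigits hL hN h
  have hsqrt : ∀ {θ : ℝ} {b : ℕ} {x : ℝ}, θ ∈ Set.Icc (0 : ℝ) 1 → 1 ≤ b → 0 < x →
      ((b + 1) * (b + 2) : ℝ) ≤ x ^ 2 → 1 / x ≤ ratio θ b ^ (1 / 2 : ℝ) := by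
    intro θ b x hθ hb hx h
    rw [← Real.sqrt_eq_rpow]
    refine Real.le_sqrt_of_sq_le (le_trans ?_ (le_ratio hθ hb))
    rw [one_div_pow]
    gcongr
  have key : ENNReal.ofReal (1 / 2) ≤ dimH (F c) := by
    -- The constant 4: a block has 2^(f+1) digits, each of weight at least 2^(-(f+3)). The single
    -- digit 1 has weight at least 1/√6 > 1/4.
    refine le_dimH_of_digits (D := blockDigits 1 (fun k => 2 ^ (k + 1)) f) (c := fun _ => 4)
      (M := fun n => 2 ^ (f n + 2)) (by norm_num) h1 ?_ (fun _ => by norm_num) ?_ ?_ ?_ ?_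
    · intro n a ha
      have h : a + 1 ≤ 2 ^ (f n + 2) := by
        unfold blockDigits at ha
        split_ifs at ha
        · have := (Finset.mem_Icc.1 ha).2
          have : 2 ^ 2 ≤ 2 ^ (f n + 2) := Nat.pow_le_pow_right (by norm_num) (by omega)
          omega
        · exact (Finset.mem_Ico.1 ha).2
      exact_mod_cast h
    · intro n θ hθ
      unfold blockDigits
      split_ifs
      · rw [Finset.Icc_self, Finset.sum_singleton]
        have := hsqrt (b := 1) (x := 4) hθ le_rfl (by norm_num) (by norm_num)
        linarith
      · have : ∀ b ∈ Finset.Ico (2 ^ (f n + 1)) (2 ^ (f n + 1 + 1)),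
            (1 / 2 ^ (f n + 3) : ℝ) ≤ ratio θ b ^ (1 / 2 : ℝ) := by
          intro b hb
          rw [Finset.mem_Ico] at hb
          have hb1 : 1 ≤ b := Nat.one_le_two_pow.trans hb.1
          refine hsqrt hθ hb1 (by positivity) ?_
          have e : (b : ℝ) + 1 ≤ 2 ^ (f n + 1 + 1) := by exact_mod_cast hb.2
          have e1 : (1 : ℝ) ≤ b := by exact_mod_cast hb1
          have e2 : (2 : ℝ) ^ (f n + 3) = 2 * 2 ^ (f n + 1 + 1) := by ring
          rw [e2]
          nlinarith
        have := Finset.card_nsmul_le_sum _ _ _ this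
        rw [Nat.card_Ico, nsmul_eq_mul, show 2 ^ (f n + 1 + 1) - 2 ^ (f n + 1) = 2 ^ (f n + 1) by
          rw [pow_succ 2 (f n + 1)]; omega] at this
        have e : 4 * (((2 ^ (f n + 1) : ℕ) : ℝ) * (1 / 2 ^ (f n + 3))) = 1 := by
          push_cast
          field_simp
          ring
        linarith
    · intro ε hε
      -- 4^n = 2^(2n), and n ≤ (f n + C)/c.
      obtain ⟨K, hK⟩ := exists_two_rpow_mul_le (A := 2 / c) (B := 2 * C / c) hε
      refine ⟨K, fun a ha n => ?_⟩
      have hp : ∀ k, 1 ≤ a k := fun k => h1 k _ (ha k)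
      have h0 := cylLength_pos hp n
      refine le_trans ?_ (hK (f n) _ h0 (cylLength_sq_le hf0 hf hp ha n))
      gcongr
      rw [Finset.prod_const, Finset.card_range]
      have e : (4 : ℝ) ^ n = 2 ^ (2 * (n : ℝ)) := by
        rw [Real.rpow_mul (by norm_num), Real.rpow_natCast]; norm_num
      rw [e]
      refine Real.rpow_le_rpow_of_exponent_le (by norm_num) ?_
      have := (abs_le.1 (hC n)).1
      rw [Real.rpow_one] at this
      rw [div_mul_eq_mul_div, ← add_div, le_div_iff₀ hc]
      linarith
    · intro ε hε
      -- 2(f n + 2) + (f (n + 1) + 2) ≤ 3 f n + 7.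
      obtain ⟨K, hK⟩ := exists_two_rpow_mul_le (A := 3) (B := 7) hε
      refine ⟨K, fun a ha n => ?_⟩
      have hp : ∀ k, 1 ≤ a k := fun k => h1 k _ (ha k)
      have h0 := cylLength_pos hp n
      refine le_trans ?_ (hK (f n) _ h0 (cylLength_sq_le hf0 hf hp ha n))
      gcongr
      have e : (2 : ℝ) ^ ((3 : ℝ) * f n + 7) = 2 ^ (3 * f n + 7) := by
        rw [← Real.rpow_natCast]; push_cast; rfl
      rw [e, ← pow_mul, ← pow_add]
      refine pow_le_pow_right₀ (by norm_num) ?_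
      have := hf n
      omega
    · intro a ha
      rw [F_eq]
      exact cfValue_mem_E hL hN hf0 hf one_pos hC ha
  rwa [ENNReal.ofReal_div_of_pos (by norm_num), ENNReal.ofReal_one, ENNReal.ofReal_ofNat] at key

/-! ### Lower bound for `E β c`. -/

/-- The sum telescopes: each ratio is (1 + θ)(1/(a + θ) - 1/(a + 1 + θ)). -/
theorem sum_ratio {θ : ℝ} (hθ : 0 ≤ θ) (N : ℕ) :
    ∑ a ∈ Finset.Icc 1 N, ratio θ a = N / (N + 1 + θ) := by
  induction N with
  | zero => simp
  | succ N ih =>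
    rw [Finset.sum_Icc_succ_top (by omega), ih, ratio]
    push_cast
    field_simp
    ring

/-- As every ratio is at most 1/2, ratio^s ≥ 2^(1-s) · ratio. The ratios sum to nearly 1 and 2^(1-s)
> 1; N is taken so large that 2^(1-s) N ≥ N + 2 ≥ N + 1 + θ. -/
theorem exists_sum_ratio_rpow_ge {s : ℝ} (hs : s < 1) : ∃ N : ℕ, ∀ θ ∈ Set.Icc (0 : ℝ) 1,
    1 ≤ ∑ a ∈ Finset.Icc 1 N, ratio θ a ^ s := by
  have hgt : (1 : ℝ) < 2 ^ (1 - s) := Real.one_lt_rpow (by norm_num) (by linarith)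
  obtain ⟨N, hN⟩ := exists_nat_gt (2 / ((2 : ℝ) ^ (1 - s) - 1))
  refine ⟨N, fun θ hθ => ?_⟩
  have h1 : ∀ a ∈ Finset.Icc 1 N, (2 : ℝ) ^ (1 - s) * ratio θ a ≤ ratio θ a ^ s := by
    intro a ha
    have ha := (Finset.mem_Icc.1 ha).1
    have hr := ratio_pos hθ.1 ha
    have : (2 : ℝ) ≤ (ratio θ a)⁻¹ := by
      rw [le_inv_comm₀ (by norm_num) hr, ← one_div]; exact ratio_le_half hθ.1 ha
    calc (2 : ℝ) ^ (1 - s) * ratio θ a ≤ (ratio θ a)⁻¹ ^ (1 - s) * ratio θ a := by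
          have := sub_pos.2 hs
          gcongr
      _ = ratio θ a ^ (-(1 - s)) * ratio θ a ^ (1 : ℝ) := by
          rw [Real.inv_rpow hr.le, ← Real.rpow_neg hr.le, Real.rpow_one]
      _ = _ := by rw [← Real.rpow_add hr]; congr 1; ring
  refine le_trans ?_ (Finset.sum_le_sum h1)
  rw [← Finset.mul_sum, sum_ratio hθ.1, ← mul_div_assoc,
    le_div_iff₀ (by linarith [hθ.1, (Nat.cast_nonneg N : (0 : ℝ) ≤ N)])]
  rw [div_lt_iff₀ (by linarith)] at hN
  linarith [hθ.2]

/-- Sublinear powers are dominated by linear functions of arbitrarily small slope. -/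
theorem exists_mul_rpow_le {A γ ε : ℝ} (hA : 0 < A) (h0 : 0 < γ) (h1 : γ < 1) (hε : 0 < ε) :
    ∃ K : ℝ, ∀ x : ℝ, 0 ≤ x → A * x ^ γ ≤ ε * x + K := by
  -- T is where A x^γ meets εx; Bernoulli's inequality is the tangent bound there, with slope γε <
  -- ε.
  set T := (ε / A) ^ (1 / (γ - 1)) with hT
  have hTpos : 0 < T := by positivity
  have hTγ : A * T ^ (γ - 1) = ε := by
    rw [hT, ← Real.rpow_mul (by positivity), one_div_mul_cancel (by linarith), Real.rpow_one]
    field_simp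
  refine ⟨A * T ^ γ, fun x hx => ?_⟩
  have h := rpow_one_add_le_one_add_mul_self (s := x / T - 1) (p := γ)
    (by have : 0 ≤ x / T := by positivity
        linarith) h0.le h1.le
  rw [add_sub_cancel, Real.div_rpow hx hTpos.le, div_le_iff₀ (by positivity)] at h
  have e : A * T ^ γ = ε * T := by
    rw [← hTγ, mul_assoc, ← Real.rpow_add_one hTpos.ne', sub_add_cancel]
  have e2 : ε * T * (x / T) = ε * x := by field_simp
  calc A * x ^ γ ≤ A * ((1 + γ * (x / T - 1)) * T ^ γ) := by gcongr
    _ = ε * T * (1 - γ) + γ * (ε * x) := by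
      rw [← e2, ← e]; ring
    _ ≤ _ := by
      rw [e]
      nlinarith [mul_pos hε hTpos, mul_nonneg hε.le hx]

/-- With y = N + 3 + f n = O((n+1)^β) and log y ≤ y^(1-β)/(1-β), the logarithm of the power is
O((n+1)^(β(2-β))), and β(2-β) = 1 - (1-β)² < 1. The exponent 2 f n + 3 serves both ∏ c_i (2 f n) and
the separation constants (3). -/
theorem exists_pow_mul_le {β c C ε : ℝ} (h0 : 0 < β) (h1 : β < 1) (hc : 0 < c) {f : ℕ → ℕ}
    (hC : ∀ n : ℕ, |(f n : ℝ) - c * (n : ℝ) ^ β| ≤ C) (N : ℕ) (hε : 0 < ε) : ∃ K : ℝ, ∀ n : ℕ,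
      ((N + 3 + f n : ℕ) : ℝ) ^ (2 * f n + 3) * ((1 / 2 : ℝ) ^ n) ^ ε ≤ K := by
  have hη : 0 < 1 - β := by linarith
  have hC0 : 0 ≤ C := (abs_nonneg _).trans (hC 0)
  set B := N + 3 + C + c with hB
  have hBpos : 0 < B := by positivity
  have hl2 : 0 < Real.log 2 := Real.log_pos (by norm_num)
  obtain ⟨K, hK⟩ := exists_mul_rpow_le (A := 2 / (1 - β) * B ^ (2 - β)) (γ := β * (2 - β))
    (ε := ε * Real.log 2) (by positivity) (mul_pos h0 (by linarith)) (by nlinarith)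
    (by positivity)
  refine ⟨Real.exp (ε * Real.log 2 + K), fun n => ?_⟩
  set y : ℝ := ((N + 3 + f n : ℕ) : ℝ) with hy
  have hy3 : (3 : ℝ) ≤ y := by rw [hy]; exact_mod_cast (by omega)
  have hypos : 0 < y := by linarith
  have hyB : y ≤ B * ((n : ℝ) + 1) ^ β := by
    have e1 : (1 : ℝ) ≤ ((n : ℝ) + 1) ^ β :=
      Real.one_le_rpow (by linarith [(Nat.cast_nonneg n : (0 : ℝ) ≤ n)]) h0.le
    have e2 : (n : ℝ) ^ β ≤ ((n : ℝ) + 1) ^ β := by gcongr; linarith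
    have e3 := (abs_le.1 (hC n)).2
    have e4 : y = N + 3 + f n := by rw [hy]; push_cast; ring
    have e5 : (0 : ℝ) ≤ N := Nat.cast_nonneg N
    rw [e4, hB]
    nlinarith
  have hlog : Real.log y * (2 * f n + 3 : ℕ) ≤ ε * Real.log 2 * (n + 1) + K := by
    calc Real.log y * (2 * f n + 3 : ℕ) ≤ y ^ (1 - β) / (1 - β) * (2 * y) := by
          have : ((2 * f n + 3 : ℕ) : ℝ) ≤ 2 * y := by rw [hy]; exact_mod_cast (by omega)
          exact mul_le_mul (Real.log_le_rpow_div hypos.le hη) this (by positivity) (by positivity)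
      _ = 2 / (1 - β) * y ^ (2 - β) := by
        rw [show 2 - β = (1 - β) + 1 by ring, Real.rpow_add_one hypos.ne']; ring
      _ ≤ 2 / (1 - β) * (B * ((n : ℝ) + 1) ^ β) ^ (2 - β) := by
        have : 0 < 2 - β := by linarith
        gcongr
      _ = 2 / (1 - β) * B ^ (2 - β) * ((n : ℝ) + 1) ^ (β * (2 - β)) := by
        rw [Real.mul_rpow hBpos.le (by positivity), ← Real.rpow_mul (by positivity)]; ring
      _ ≤ _ := hK _ (by positivity)
  have e1 : y ^ (2 * f n + 3) = Real.exp (Real.log y * (2 * f n + 3 : ℕ)) := by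
    rw [← Real.rpow_natCast, Real.rpow_def_of_pos hypos]
  have e2 : ((1 / 2 : ℝ) ^ n) ^ ε = Real.exp (-(ε * Real.log 2 * n)) := by
    rw [Real.rpow_def_of_pos (by positivity), Real.log_pow, one_div, Real.log_inv]
    congr 1; ring
  rw [e1, e2, ← Real.exp_add]
  exact Real.exp_le_exp.2 (by linarith)

/-- The set `E(β, c)` has dimension at least `s` for every `s < 1`. -/
theorem le_dimH_E {β c s : ℝ} (h0 : 0 < β) (h1 : β < 1) (hc : 0 < c) (hs0 : 0 < s) (hs1 : s < 1) :
    ENNReal.ofReal s ≤ dimH (E β c) := by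
  obtain ⟨f, hf0, hf, C, hC⟩ := exists_counting h0 h1.le hc fun h => absurd h h1.ne
  obtain ⟨N, hNsum⟩ := exists_sum_ratio_rpow_ge hs1
  have hL : StrictMono fun k : ℕ => N + 1 + k := fun i j hij => by simpa using hij
  have hN : N < N + 1 + 0 := by omega
  have hpos : ∀ n, ∀ a ∈ blockDigits N (fun k => N + 1 + k) f n, 1 ≤ a := fun n a h =>
    one_le_of_mem_blockDigits hL hN h
  -- When f increases, the block is the single digit N + 1 + f n, whose ratio is at least 1/((N + 2
  -- + f n)(N + 3 + f n)).
  set c' : ℕ → ℝ := fun n => if f (n + 1) = f n then 1 else ((N + 3 + f n : ℕ) : ℝ) ^ 2 with hc'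
  have hprod : ∀ n, ∏ i ∈ Finset.range n, c' i ≤ ((N + 3 + f n : ℕ) : ℝ) ^ (2 * f n) := by
    intro n
    induction n with
    | zero => simp [hf0]
    | succ n ih =>
      rw [Finset.prod_range_succ]
      rcases hf n with h | h
      · simpa only [hc', h, if_true, mul_one] using ih
      · simp only [hc', h, if_neg (Nat.succ_ne_self (f n))] at ih ⊢
        have : ((N + 3 + f n : ℕ) : ℝ) ≤ (N + 3 + (f n + 1) : ℕ) := by exact_mod_cast (by omega)
        calc _ ≤ ((N + 3 + f n : ℕ) : ℝ) ^ (2 * f n) * ((N + 3 + f n : ℕ) : ℝ) ^ 2 := by gcongr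
          _ = ((N + 3 + f n : ℕ) : ℝ) ^ (2 * (f n + 1)) := by rw [← pow_add]; congr 1
          _ ≤ _ := by gcongr
  have hlen : ∀ ε : ℝ, 0 < ε → ∀ a : ℕ → ℕ,
      (∀ k, a k ∈ blockDigits N (fun k => N + 1 + k) f k) → ∀ n,
      cylLength a n ^ ε ≤ ((1 / 2 : ℝ) ^ n) ^ ε := by
    intro ε hε a ha n
    have hp : ∀ k, 1 ≤ a k := fun k => hpos k _ (ha k)
    have := (cylLength_pos hp n).le
    have := cylLength_le hp n
    gcongr
  have hcast : ∀ n, (1 : ℝ) ≤ (N + 3 + f n : ℕ) := fun n => by exact_mod_cast (by omega)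
  refine le_dimH_of_digits (D := blockDigits N (fun k => N + 1 + k) f) (c := c')
    (M := fun n => N + 2 + f n) hs0 hpos ?_ ?_ ?_ ?_ ?_ ?_
  · intro n a ha
    have h : a ≤ N + 1 + f n := by
      unfold blockDigits at ha
      split_ifs at ha
      · have := (Finset.mem_Icc.1 ha).2
        omega
      · have : a < N + 1 + (f n + 1) := (Finset.mem_Ico.1 ha).2
        omega
    have : (a : ℝ) ≤ N + 1 + f n := by exact_mod_cast h
    linarith
  · intro n
    simp only [hc']
    split_ifs <;> positivity
  · intro n θ hθ
    simp only [hc', blockDigits]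
    split_ifs with h
    · rw [one_mul]; exact hNsum θ hθ
    · rw [← add_assoc, Nat.Ico_succ_singleton, Finset.sum_singleton]
      have hb : 1 ≤ N + 1 + f n := by omega
      have e1 := le_ratio hθ hb
      have hr := ratio_pos hθ.1 hb
      have e2 : ratio θ (N + 1 + f n) ≤ ratio θ (N + 1 + f n) ^ s := by
        conv_lhs => rw [← Real.rpow_one (ratio θ (N + 1 + f n))]
        exact Real.rpow_le_rpow_of_exponent_ge hr
          ((ratio_le_half hθ.1 hb).trans (by norm_num)) hs1.le
      have e3 := e1.trans e2
      rw [div_le_iff₀ (by positivity)] at e3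
      refine e3.trans ?_
      rw [mul_comm]
      have : (0 : ℝ) ≤ ratio θ (N + 1 + f n) ^ s := by positivity
      gcongr
      push_cast
      nlinarith [(Nat.cast_nonneg N : (0 : ℝ) ≤ N), (Nat.cast_nonneg (f n) : (0 : ℝ) ≤ f n)]
  · intro ε hε
    obtain ⟨K, hK⟩ := exists_pow_mul_le h0 h1 hc hC N hε
    refine ⟨K, fun a ha n => (le_trans ?_ (hK n))⟩
    have := hlen ε hε a ha n
    have := (hprod n).trans (pow_le_pow_right₀ (hcast n) (by omega : 2 * f n ≤ 2 * f n + 3))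
    gcongr
    exact Real.rpow_nonneg (cylLength_pos (fun k => hpos k _ (ha k)) n).le ε
  · intro ε hε
    obtain ⟨K, hK⟩ := exists_pow_mul_le h0 h1 hc hC N hε
    refine ⟨K, fun a ha n => (le_trans ?_ (hK n))⟩
    have := hlen ε hε a ha n
    have h3 : ((N : ℝ) + 2 + f n) ^ 2 * (N + 2 + f (n + 1)) ≤
        ((N + 3 + f n : ℕ) : ℝ) ^ (2 * f n + 3) := by
      have e1 : (N : ℝ) + 2 + f n ≤ (N + 3 + f n : ℕ) := by push_cast; linarith
      have e2 : (N : ℝ) + 2 + f (n + 1) ≤ (N + 3 + f n : ℕ) := by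
        have := hf n
        exact_mod_cast (by omega)
      calc _ ≤ ((N + 3 + f n : ℕ) : ℝ) ^ 2 * ((N + 3 + f n : ℕ) : ℝ) := by gcongr
        _ = ((N + 3 + f n : ℕ) : ℝ) ^ 3 := by ring
        _ ≤ _ := pow_le_pow_right₀ (hcast n) (by omega)
    gcongr
    exact Real.rpow_nonneg (cylLength_pos (fun k => hpos k _ (ha k)) n).le ε
  · intro a ha
    exact cfValue_mem_E hL hN hf0 hf h0 hC ha

theorem dimH_E {β c : ℝ} (h0 : 0 < β) (h1 : β < 1) (hc : 0 < c) : dimH (E β c) = 1 := by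
  refine le_antisymm ?_ ?_
  · exact (dimH_mono (Set.subset_univ _)).trans_eq Real.dimH_univ
  · have hcont : Tendsto (fun s : ℝ => ENNReal.ofReal s) (𝓝[<] 1) (𝓝 (ENNReal.ofReal 1)) :=
      (ENNReal.continuous_ofReal.tendsto 1).mono_left nhdsWithin_le_nhds
    rw [ENNReal.ofReal_one] at hcont
    refine le_of_tendsto hcont ?_
    filter_upwards [Ioo_mem_nhdsLT zero_lt_one] with s hs
    exact le_dimH_E h0 h1 hc hs.1 hs.2

/-! ### Upper bound for `F c`. -/

theorem inv_eq_partialQuotient_add {x : ℝ} (hx : x ∈ Set.Ioo (0 : ℝ) 1) :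
    x⁻¹ = partialQuotient x 0 + gaussMap x := by
  have h : 0 ≤ x⁻¹ := inv_nonneg.2 hx.1.le
  rw [partialQuotient, gaussMap, Function.iterate_zero_apply, natCast_floor_eq_intCast_floor h,
    Int.floor_add_fract]

theorem one_le_partialQuotient {x : ℝ} (hx : x ∈ Set.Ioo (0 : ℝ) 1) (hi : Irrational x) (k : ℕ) :
    1 ≤ partialQuotient x k := by
  have h := (gaussMap_iterate_mem hx hi k).1
  exact Nat.le_floor (by simpa using (one_le_inv₀ h.1).2 h.2.le)

/-- The diameter of a cylinder is at most the inverse square of the product of the digits. -/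
theorem abs_sub_le_prod (n : ℕ) : ∀ {x y : ℝ}, x ∈ Set.Ioo (0 : ℝ) 1 → Irrational x →
    y ∈ Set.Ioo (0 : ℝ) 1 → Irrational y →
    (∀ k < n, partialQuotient x k = partialQuotient y k) →
    |x - y| ≤ ((∏ k ∈ Finset.range n, (partialQuotient x k : ℝ)) ^ 2)⁻¹ := by
  induction n with
  | zero =>
    intro x y hx _ hy _ _
    simp only [Finset.range_zero, Finset.prod_empty, one_pow, inv_one]
    rw [abs_le]
    constructor <;> linarith [hx.1, hx.2, hy.1, hy.2]
  | succ n ih =>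
    intro x y hx hxi hy hyi h
    have gx := gaussMap_iterate_mem hx hxi 1
    have gy := gaussMap_iterate_mem hy hyi 1
    rw [Function.iterate_one] at gx gy
    have ih := ih gx.1 gx.2 gy.1 gy.2 fun k hk => h (k + 1) (by omega)
    have ex := inv_eq_partialQuotient_add hx
    have ey := inv_eq_partialQuotient_add hy
    rw [← h 0 (by omega)] at ey
    have hp : (1 : ℝ) ≤ partialQuotient x 0 := by exact_mod_cast one_le_partialQuotient hx hxi 0
    set p : ℝ := (partialQuotient x 0 : ℝ)
    have hx' : x = 1 / (p + gaussMap x) := by rw [← ex, one_div, inv_inv]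
    have hy' : y = 1 / (p + gaussMap y) := by rw [← ey, one_div, inv_inv]
    have e : |x - y| = |gaussMap x - gaussMap y| / ((p + gaussMap x) * (p + gaussMap y)) := by
      conv_lhs => rw [hx', hy']
      exact abs_one_div_sub_one_div (by linarith) gx.1.1.le gy.1.1.le
    rw [e, Finset.prod_range_succ', mul_pow, mul_inv]
    have h1 : p ^ 2 ≤ (p + gaussMap x) * (p + gaussMap y) := by
      nlinarith [gx.1.1, gy.1.1, mul_pos gx.1.1 gy.1.1]
    calc _ ≤ |gaussMap x - gaussMap y| / p ^ 2 := by gcongr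
      _ = |gaussMap x - gaussMap y| * (p ^ 2)⁻¹ := div_eq_mul_inv _ _
      _ ≤ _ := by gcongr; exact ih

/-- The j-th smallest element is at least j; the induction removes the maximum. -/
theorem factorial_card_le_prod (s : Finset ℕ) :
    (∀ x ∈ s, 1 ≤ x) → s.card.factorial ≤ ∏ x ∈ s, x := by
  induction s using Finset.induction_on_max with
  | empty => simp
  | insert a s hmax ih =>
    intro h
    have ha : a ∉ s := fun h => (hmax a h).false
    have hs : s ⊆ Finset.Ico 1 a := fun x hx =>
      Finset.mem_Ico.2 ⟨h x (Finset.mem_insert_of_mem hx), hmax x hx⟩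
    have hc := Finset.card_le_card hs
    have h1 := h a (Finset.mem_insert_self _ _)
    rw [Nat.card_Ico] at hc
    rw [Finset.card_insert_of_notMem ha, Finset.prod_insert ha, Nat.factorial_succ]
    exact Nat.mul_le_mul (by omega) (ih fun x hx => h x (Finset.mem_insert_of_mem hx))

theorem factorial_card_image_le_prod {a : ℕ → ℕ} (ha : ∀ k, 1 ≤ a k) (n : ℕ) :
    ((Finset.range n).image a).card.factorial ≤ ∏ k ∈ Finset.range n, a k := by
  refine (factorial_card_le_prod _ fun x hx => ?_).trans ?_
  · obtain ⟨k, -, rfl⟩ := Finset.mem_image.1 hx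
    exact ha k
  · induction n with
    | zero => simp
    | succ n ih =>
      rw [Finset.range_add_one, Finset.image_insert,
        Finset.prod_insert (s := Finset.range n) (by simp)]
      by_cases h : a n ∈ (Finset.range n).image a
      · rw [Finset.insert_eq_of_mem h]
        exact ih.trans (Nat.le_mul_of_pos_left _ (ha n))
      · rw [Finset.prod_insert h]
        exact Nat.mul_le_mul_left _ ih

theorem tsum_pi_prod (g : ℕ → ENNReal) (n : ℕ) :
    ∑' w : Fin n → ℕ, ∏ i, g (w i) = (∑' a, g a) ^ n := by
  induction n with
  | zero => simp
  | succ n ih =>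
    rw [← (Fin.consEquiv fun _ : Fin (n + 1) => ℕ).tsum_eq, ENNReal.tsum_prod']
    simp only [Fin.consEquiv_apply, Fin.prod_univ_succ, Fin.cons_zero, Fin.cons_succ,
      ENNReal.tsum_mul_left, ih, ENNReal.tsum_mul_right]
    rw [pow_succ']

/-- The words of length `n` whose product is at least `k!`, weighted by a power of the product. -/
theorem tsum_words_le {η : ℝ} (hη : 0 < η) (n k : ℕ) :
    ∑' w : {w : Fin n → ℕ // k.factorial ≤ ∏ i, w i},
      ENNReal.ofReal ((∏ i, (w.1 i : ℝ)) ^ (-(1 + 2 * η))) ≤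
    ENNReal.ofReal ((∑' a : ℕ, (a : ℝ) ^ (-(1 + η))) ^ n * (k.factorial : ℝ) ^ (-η)) := by
  -- The letter 0 is harmless: `0 ^ (-(1 + η))` is 0 by convention.
  have hsum : Summable fun a : ℕ => (a : ℝ) ^ (-(1 + η)) :=
    Real.summable_nat_rpow.2 (by linarith)
  have hnn : ∀ a : ℕ, (0 : ℝ) ≤ (a : ℝ) ^ (-(1 + η)) := fun a => by positivity
  calc _ ≤ ∑' w : {w : Fin n → ℕ // k.factorial ≤ ∏ i, w i},
        (∏ i, ENNReal.ofReal ((w.1 i : ℝ) ^ (-(1 + η)))) *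
          ENNReal.ofReal ((k.factorial : ℝ) ^ (-η)) := by
        refine ENNReal.tsum_le_tsum fun w => ?_
        have hk : (k.factorial : ℝ) ≤ ∏ i, (w.1 i : ℝ) := by exact_mod_cast w.2
        have hk0 : (0 : ℝ) < k.factorial := by exact_mod_cast k.factorial_pos
        rw [← ENNReal.ofReal_prod_of_nonneg fun i _ => hnn _,
          ← ENNReal.ofReal_mul (Finset.prod_nonneg fun i _ => hnn _),
          Real.finsetProd_rpow _ _ fun i _ => Nat.cast_nonneg _]
        refine ENNReal.ofReal_le_ofReal ?_
        -- The exponent -(1 + η) makes the sum over letters converge; the remaining -η is spent on P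
        -- ≥ k!.
        rw [show -(1 + 2 * η) = -(1 + η) + -η by ring, Real.rpow_add (hk0.trans_le hk)]
        exact mul_le_mul_of_nonneg_left (Real.rpow_le_rpow_of_nonpos hk0 hk (by linarith))
          (Real.rpow_nonneg (hk0.trans_le hk).le _)
    _ ≤ ∑' w : Fin n → ℕ, (∏ i, ENNReal.ofReal ((w i : ℝ) ^ (-(1 + η)))) *
          ENNReal.ofReal ((k.factorial : ℝ) ^ (-η)) :=
        ENNReal.tsum_comp_le_tsum_of_injective Subtype.val_injective _
    _ = _ := by
        rw [ENNReal.tsum_mul_right, tsum_pi_prod fun a => ENNReal.ofReal ((a : ℝ) ^ (-(1 + η))),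
          ← ENNReal.ofReal_tsum_of_nonneg hnn hsum, ← ENNReal.ofReal_pow (tsum_nonneg hnn),
          ← ENNReal.ofReal_mul (pow_nonneg (tsum_nonneg hnn) _)]

/-- Irrational numbers for which at least `δ n` of the first `n` partial quotients are distinct, for
every `n ≥ m`. -/
def manyDistinct (δ : ℝ) (m : ℕ) : Set ℝ :=
  {ω | ω ∈ Set.Ioo (0 : ℝ) 1 ∧ Irrational ω ∧ ∀ n ≥ m, ⌊δ * n⌋₊ ≤ R n ω}

/-- Since n ≤ (k + 1)/δ, Z^n is at most Z^(1/δ) (Y^k)^η with Y = Z^(1/(δη)), and Y^k/k! ≤ e^Y. -/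
theorem pow_mul_factorial_rpow_le {Z δ η : ℝ} (hZ : 1 ≤ Z) (hδ : 0 < δ) (hη : 0 < η) (n : ℕ) :
    Z ^ n * ((⌊δ * n⌋₊.factorial : ℕ) : ℝ) ^ (-η) ≤
      Z ^ (1 / δ) * Real.exp (Z ^ (1 / (δ * η))) ^ η := by
  set k := ⌊δ * n⌋₊
  have hk0 : (0 : ℝ) < k.factorial := by exact_mod_cast k.factorial_pos
  have h1 : (n : ℝ) ≤ 1 / δ + 1 / δ * k := by
    have := Nat.lt_floor_add_one (δ * n)
    rw [← mul_one_add, one_div, inv_mul_eq_div, le_div_iff₀ hδ]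
    linarith
  have hZ0 : 0 < Z := by linarith
  have h2 : Z ^ n ≤ Z ^ (1 / δ) * ((Z ^ (1 / (δ * η))) ^ k) ^ η := by
    calc Z ^ n = Z ^ (n : ℝ) := (Real.rpow_natCast _ _).symm
      _ ≤ Z ^ (1 / δ + 1 / δ * k) := Real.rpow_le_rpow_of_exponent_le hZ h1
      _ = _ := by
        rw [Real.rpow_add hZ0, ← Real.rpow_natCast, ← Real.rpow_mul hZ0.le, ← Real.rpow_mul hZ0.le]
        congr 2
        field_simp
  have h3 := Real.pow_div_factorial_le_exp (x := Z ^ (1 / (δ * η))) (by positivity) k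
  calc _ ≤ Z ^ (1 / δ) * ((Z ^ (1 / (δ * η))) ^ k) ^ η * (k.factorial : ℝ) ^ (-η) := by gcongr
    _ = Z ^ (1 / δ) * ((Z ^ (1 / (δ * η))) ^ k / k.factorial) ^ η := by
      rw [Real.rpow_neg hk0.le, Real.div_rpow (by positivity) hk0.le]
      ring
    _ ≤ _ := by gcongr

theorem dimH_manyDistinct_le {δ η : ℝ} (hδ : 0 < δ) (hη : 0 < η) (m : ℕ) :
    dimH (manyDistinct δ m) ≤ ENNReal.ofReal (1 / 2 + η) := by
  set k : ℕ → ℕ := fun n => ⌊δ * n⌋₊ with hk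
  have hktop : Tendsto k atTop atTop :=
    tendsto_nat_floor_atTop.comp (tendsto_natCast_atTop_atTop.const_mul_atTop hδ)
  let t : ∀ n, {w : Fin n → ℕ // (k n).factorial ≤ ∏ i, w i} → Set ℝ := fun n w =>
    {ω | ω ∈ Set.Ioo (0 : ℝ) 1 ∧ Irrational ω ∧ ∀ i : Fin n, partialQuotient ω i = w.1 i}
  have hdiam : ∀ n w, Metric.ediam (t n w) ≤ ENNReal.ofReal ((∏ i, (w.1 i : ℝ)) ^ 2)⁻¹ := by
    intro n w
    refine Metric.ediam_le_of_forall_dist_le fun x hx y hy => ?_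
    rw [Real.dist_eq]
    have := abs_sub_le_prod n hx.1 hx.2.1 hy.1 hy.2.1 fun i hi =>
      (hx.2.2 ⟨i, hi⟩).trans (hy.2.2 ⟨i, hi⟩).symm
    rwa [Finset.prod_range, Finset.prod_congr rfl fun i _ => by rw [hx.2.2 i]] at this
  have hfac : ∀ n (w : {w : Fin n → ℕ // (k n).factorial ≤ ∏ i, w i}),
      ((k n).factorial : ℝ) ≤ ∏ i, (w.1 i : ℝ) := fun n w => by exact_mod_cast w.2
  have hfac1 : ∀ n, (1 : ℝ) ≤ (k n).factorial := fun n => by exact_mod_cast (k n).factorial_pos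
  -- The covers are the level-n cylinders with digit product P ≥ k!; their diameters are at most P⁻²
  -- ≤ 1/k!, which tends to 0.
  have hle := MeasureTheory.Measure.hausdorffMeasure_le_liminf_tsum (1 / 2 + η)
    (manyDistinct δ m) (l := atTop) (fun n => (((k n).factorial : ℕ) : ENNReal)⁻¹)
    (ENNReal.tendsto_inv_nat_nhds_zero.comp (factorial_tendsto_atTop.comp hktop)) t
    (Eventually.of_forall fun n w => by
      refine (hdiam n w).trans ?_
      have h1 := hfac n w
      have h2 := hfac1 n
      rw [← ENNReal.ofReal_natCast, ← ENNReal.ofReal_inv_of_pos (by linarith)]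
      refine ENNReal.ofReal_le_ofReal (inv_anti₀ (by linarith) ?_)
      nlinarith)
    (by
      filter_upwards [eventually_ge_atTop m] with n hn ω hω
      have hp := one_le_partialQuotient hω.1 hω.2.1
      refine Set.mem_iUnion.2 ⟨⟨fun i => partialQuotient ω i, ?_⟩, hω.1, hω.2.1, fun i => rfl⟩
      rw [← Finset.prod_range fun i => partialQuotient ω i]
      exact (Nat.factorial_le (hω.2.2 n hn)).trans (factorial_card_image_le_prod hp n))
  set Z : ℝ := ∑' a : ℕ, (a : ℝ) ^ (-(1 + η)) with hZ
  have hsum : Summable fun a : ℕ => (a : ℝ) ^ (-(1 + η)) :=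
    Real.summable_nat_rpow.2 (by linarith)
  have hZ1 : 1 ≤ Z := by
    have := hsum.le_tsum 1 fun a _ => by positivity
    rwa [Nat.cast_one, Real.one_rpow] at this
  have hbd : ∀ n, ∑' w, Metric.ediam (t n w) ^ (1 / 2 + η) ≤
      ENNReal.ofReal (Z ^ (1 / δ) * Real.exp (Z ^ (1 / (δ * η))) ^ η) := by
    intro n
    calc _ ≤ ∑' w : {w : Fin n → ℕ // (k n).factorial ≤ ∏ i, w i},
          ENNReal.ofReal ((∏ i, (w.1 i : ℝ)) ^ (-(1 + 2 * η))) := by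
          refine ENNReal.tsum_le_tsum fun w => ?_
          have hP : (0 : ℝ) < ∏ i, (w.1 i : ℝ) := by linarith [hfac n w, hfac1 n]
          calc _ ≤ ENNReal.ofReal ((∏ i, (w.1 i : ℝ)) ^ 2)⁻¹ ^ (1 / 2 + η) := by
                gcongr
                exact hdiam n w
            _ = _ := by
              rw [ENNReal.ofReal_rpow_of_pos (by positivity)]
              congr 1
              rw [← Real.rpow_natCast, ← Real.rpow_neg hP.le, ← Real.rpow_mul hP.le]
              congr 1
              push_cast
              ring
      _ ≤ _ := (tsum_words_le hη n (k n)).trans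
        (ENNReal.ofReal_le_ofReal (pow_mul_factorial_rpow_le hZ1 hδ hη n))
  have hfin : MeasureTheory.Measure.hausdorffMeasure (1 / 2 + η) (manyDistinct δ m) ≠ ⊤ := by
    refine ne_top_of_le_ne_top ENNReal.ofReal_ne_top
      (hle.trans ((liminf_le_liminf (Eventually.of_forall hbd)).trans_eq (liminf_const _)))
  refine dimH_le_of_hausdorffMeasure_ne_top ?_
  rwa [Real.coe_toNNReal _ (by positivity)]

theorem dimH_F_le {c : ℝ} (hc : 0 < c) : dimH (F c) ≤ 1 / 2 := by
  have hsub : F c ⊆ ⋃ m, manyDistinct (c / 2) m := by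
    intro ω hω
    obtain ⟨m, hm⟩ := eventually_atTop.1 (hω.2.2.eventually_const_le (half_lt_self hc))
    -- Using m + 1 ensures n > 0, so that the quotient by n can be cleared.
    refine Set.mem_iUnion.2 ⟨m + 1, hω.1, hω.2.1, fun n hn => ?_⟩
    have h := hm n (by omega)
    rw [le_div_iff₀ (by exact_mod_cast (by omega : 0 < n))] at h
    exact Nat.floor_le_of_le h
  have hcont : Tendsto (fun η : ℝ => ENNReal.ofReal (1 / 2 + η)) (𝓝[>] 0)
      (𝓝 (ENNReal.ofReal (1 / 2 + 0))) :=
    ((ENNReal.continuous_ofReal.comp (continuous_const.add continuous_id)).tendsto 0).mono_left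
      nhdsWithin_le_nhds
  rw [add_zero, ENNReal.ofReal_div_of_pos (by norm_num), ENNReal.ofReal_one,
    ENNReal.ofReal_ofNat] at hcont
  refine ge_of_tendsto hcont ?_
  filter_upwards [self_mem_nhdsWithin] with η hη
  refine (dimH_mono hsub).trans ?_
  rw [dimH_iUnion]
  exact iSup_le fun m => dimH_manyDistinct_le (by linarith) hη m

end ContFracRange

end

theorem theorem2 :
    (∀ β : ℝ, 0 < β → β < 1 → ∀ c : ℝ, 0 < c → dimH (ContFracRange.E β c) = 1) ∧
    (∀ c : ℝ, 0 < c → c ≤ 1 → dimH (ContFracRange.F c) = 1 / 2) :=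
  ⟨fun _ h0 h1 _ hc => ContFracRange.dimH_E h0 h1 hc, fun _ hc hc1 =>
    le_antisymm (ContFracRange.dimH_F_le hc) (ContFracRange.half_le_dimH_F hc hc1)⟩
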